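/- Let $\Bbbk$ be a field of characteristic $0$, let $n\ge 4$, $D=\lceil n/2\rceil$, and let $A_n=\Bbbk[x_1,\dots,x_{n-1}]/(x_1,\dots,x_{n-1})^2$. Let $G(A_n)$ be its Galois closure over $\Bbbk$, that is $G(A_n)=A_n^{\otimes n}/\bigl(s_j(a)-e_j(a) : a\in A_n,\ 1\le j\le n\bigr)$, where $\sum_j(-1)^js_j(a)t^{n-j}$ is the characteristic polynomial of multiplication by $a$ on $A_n$ and $e_j(a)$ is the $j$-th elementary symmetric function of $a^{(1)},\dots,a^{(n)}$, with $a^{(i)}=1\otimes\cdots\otimes a\otimes\cdots\otimes1$ ($a$ in position $i$). Put $x_{i,j}=x_i^{(j)}\in G(A_n)$ for $1\le i<n$, $1\le j\le n$, put $x_{0,j}=1$, let $\mathfrak m$ be the ideal generated by the $x_{i,j}$ with $i\geq 1$, and let $\mathrm{Ann}(\mathfrak m^2)=\{g\in G(A_n) : g\,\mathfrak m^2=0\}$. For $d=(d_1,\dots,d_{n-1})\in\mathbb Z_{\ge0}^{n-1}$ let $G(A_n)_d$ be the component of multidegree $d$, where $x_{i,j}$ has as its multidegree the $i$-th unit vector.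 For a partition $\mu$ of $n$, number the boxes of its diagram $1,\dots,n$ from left to right and from top to bottom, let $M_\mu$ be the $S_n$-module with basis the tabloids of shape $\mu$, let $V_\mu\subseteq M_\mu$ be the Specht module (spanned by the polytabloids), and let $\{t_\mu\}$ be the tabloid of the tableau whose $i$-th box has label $i$. Let $a=(n-\sum_i d_i,d_1,\dots,d_{n-1})$ and let $\lambda=(\lambda_1\ge\dots\ge\lambda_n)$ be its decreasing rearrangement. For $\sigma\in S_n$ with $\lambda_i=a_{\sigma^{-1}(i)}$ for all $i$, and for a generalized tableau $T$ of shape $\mu$ and content $\lambda$, let $\theta_{T,\sigma}:M_\mu\to G(A_n)$ be the $S_n$-equivariant linear map (with $\pi\in S_n$ acting on $G(A_n)$ by $x_{i,j}\mapsto x_{i,\pi(j)}$) such that $$\theta_{T,\sigma}(\{t_\mu\})=\sum_{S}\ \prod_{i=1}^n x_{S(i)-1,\,i},$$ where $S$ runs over the distinct tableaux obtained from $\sigma^{-1}T$, $(\sigma^{-1}T)(i)=\sigma^{-1}(T(i))$, by permuting the labels within each row. Let $d\in\mathbb Z_{\ge0}^{n-1}$ satisfy $\sum_k d_k<D$. (a)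 If $n$ is even, then $G(A_n)_d\cap\mathrm{Ann}(\mathfrak m^2)=0$. (b) If $n$ is odd, let $\varepsilon=(D,D-1)$. Then, for every $\sigma\in S_n$ with $\lambda_i=a_{\sigma^{-1}(i)}$ for all $i$, $$G(A_n)_d\cap\mathrm{Ann}(\mathfrak m^2)\subseteq\sum_T\theta_{T,\sigma}(V_\varepsilon),$$ where $T$ runs over the semi-standard tableaux of shape $\varepsilon$ and content $\lambda$ (if there are none, the sum is $0$). -/

import Mathlib

open scoped TensorProduct

noncomputable section

/-! ## Galois closures of ring extensions -/

/-- The element `a^{(i)} = 1 ⊗ ⋯ ⊗ a ⊗ ⋯ ⊗ 1` (with `a` in position `i`) of `A^{⊗ n}`,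
the tensor power being taken over `B`. -/
def tensorConj (B A : Type*) [CommRing B] [CommRing A] [Algebra B A] (n : ℕ)
    (i : Fin n) (a : A) : ⨂[B] _ : Fin n, A :=
  PiTensorProduct.singleAlgHom (R := B) (A := fun _ : Fin n => A) i a

/-- `s_j(a) ∈ B`, where `p_a(t) = ∑_j (-1)^j s_j(a) t^{n-j}` is the characteristic polynomial of
multiplication by `a` on the free rank `n` algebra `A`. -/
def charCoeff (B A : Type*) [CommRing B] [CommRing A] [Algebra B A]
    [Module.Free B A] [Module.Finite B A] (n j : ℕ) (a : A) : B :=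
  (-1) ^ j * (LinearMap.charpoly (LinearMap.mulLeft B a)).coeff (n - j)

/-- The ideal of `A^{⊗ n}` generated by all `s_j(a) - e_j(a)`, for `a ∈ A` and `1 ≤ j ≤ n`, where
`e_j(a)` is the `j`-th elementary symmetric function of `a^{(1)}, …, a^{(n)}`. -/
def galoisClosureIdeal (B A : Type*) [CommRing B] [CommRing A] [Algebra B A]
    [Module.Free B A] [Module.Finite B A] (n : ℕ) : Ideal (⨂[B] _ : Fin n, A) :=
  Ideal.span {z | ∃ (a : A) (j : ℕ), 1 ≤ j ∧ j ≤ n ∧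
    z = algebraMap B (⨂[B] _ : Fin n, A) (charCoeff B A n j a)
      - MvPolynomial.aeval (fun i => tensorConj B A n i a) (MvPolynomial.esymm (Fin n) B j)}

/-- The Galois closure `G(A/B)` of a `B`-algebra `A` that is free of rank `n` as a `B`-module. -/
abbrev GaloisClosure (B A : Type*) [CommRing B] [CommRing A] [Algebra B A]
    [Module.Free B A] [Module.Finite B A] (n : ℕ) : Type _ :=
  (⨂[B] _ : Fin n, A) ⧸ galoisClosureIdeal B A n

/-! ## The algebra `A_n` with `n = m + 1`, and its Galois closure -/

/-- `A_{m+1} = k[x_1, …, x_m] / (x_1, …, x_m)^2`, a `k`-algebra of rank `m + 1`. -/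
abbrev AAlg (k : Type*) [Field k] (m : ℕ) : Type _ :=
  MvPolynomial (Fin m) k ⧸
    (Ideal.span (Set.range (MvPolynomial.X : Fin m → MvPolynomial (Fin m) k))) ^ 2

/-- The class of the variable `x_i` in `A_{m+1}`. -/
def aVar (k : Type*) [Field k] (m : ℕ) (i : Fin m) : AAlg k m :=
  Ideal.Quotient.mk _ (MvPolynomial.X i)

theorem aVar_mul (k : Type*) [Field k] (m : ℕ) (i j : Fin m) : aVar k m i * aVar k m j = 0 := by
  unfold aVar
  rw [← map_mul, Ideal.Quotient.eq_zero_iff_mem, pow_two]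
  exact Ideal.mul_mem_mul (Ideal.subset_span ⟨i, rfl⟩) (Ideal.subset_span ⟨j, rfl⟩)

instance AAlg.instFinite (k : Type*) [Field k] (m : ℕ) : Module.Finite k (AAlg k m) := by
  classical
  have key : ∀ p : MvPolynomial (Fin m) k, (Ideal.Quotient.mk _ p : AAlg k m) ∈
      Submodule.span k (insert (1 : AAlg k m) (Set.range (aVar k m))) := by
    intro p
    induction p using MvPolynomial.induction_on with
    | C a =>
      have h : (Ideal.Quotient.mk _ (MvPolynomial.C a) : AAlg k m) = a • (1 : AAlg k m) := by
        rw [Algebra.smul_def, mul_one]; rfl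
      rw [h]
      exact Submodule.smul_mem _ _ (Submodule.subset_span (Set.mem_insert _ _))
    | add p q hp hq => rw [map_add]; exact Submodule.add_mem _ hp hq
    | mul_X p i hp =>
      rw [map_mul]
      change _ * aVar k m i ∈ _
      generalize (Ideal.Quotient.mk _ p : AAlg k m) = y at hp ⊢
      induction hp using Submodule.span_induction with
      | mem x hx =>
        rcases hx with rfl | ⟨j, rfl⟩
        · rw [one_mul]
          exact Submodule.subset_span (Set.mem_insert_of_mem _ ⟨i, rfl⟩)
        · rw [aVar_mul]; exact Submodule.zero_mem _
      | zero => rw [zero_mul]; exact Submodule.zero_mem _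
      | add x y _ _ hx hy => rw [add_mul]; exact Submodule.add_mem _ hx hy
      | smul c x _ hx => rw [smul_mul_assoc]; exact Submodule.smul_mem _ _ hx
  refine Module.finite_def.mpr ?_
  rw [Submodule.fg_def]
  refine ⟨_, (Set.finite_range (aVar k m)).insert 1, ?_⟩
  rw [eq_top_iff]
  rintro x -
  obtain ⟨p, rfl⟩ := Ideal.Quotient.mk_surjective x
  exact key p

/-- `G(A_n)` for `n = m + 1`. -/
abbrev GA (k : Type*) [Field k] (m : ℕ) : Type _ :=
  GaloisClosure k (AAlg k m) (m + 1)

/-- The element `x_{i,j} = x_i^{(j)}` of `G(A_n)`. -/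
def xVar (k : Type*) [Field k] (m : ℕ) (i : Fin m) (j : Fin (m + 1)) : GA k m :=
  Ideal.Quotient.mk _ (tensorConj k (AAlg k m) (m + 1) j (aVar k m i))

/-- The presentation `k[x_{i,j} | 1 ≤ i < n, 1 ≤ j ≤ n] → G(A_n)`. -/
def presentation (k : Type*) [Field k] (m : ℕ) :
    MvPolynomial (Fin m × Fin (m + 1)) k →ₐ[k] GA k m :=
  MvPolynomial.aeval (fun p => xVar k m p.1 p.2)

/-- The multidegree of `x_{i,j}` is the `i`-th unit vector. -/
def multiWeight (m : ℕ) (p : Fin m × Fin (m + 1)) : Fin m → ℕ :=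
  Pi.single p.1 1

/-- The multigraded component `G(A_n)_d`: the image of the polynomials in the `x_{i,j}` that are
homogeneous of multidegree `d`. -/
def gradedPiece (k : Type*) [Field k] (m : ℕ) (d : Fin m → ℕ) : Submodule k (GA k m) :=
  (MvPolynomial.weightedHomogeneousSubmodule k (multiWeight m) d).map
    (presentation k m).toLinearMap

/-- The ideal of `G(A_n)` generated by all `x_{i,j}`. -/
def maxIdeal (k : Type*) [Field k] (m : ℕ) : Ideal (GA k m) :=
  Ideal.span (Set.range fun p : Fin m × Fin (m + 1) => xVar k m p.1 p.2)

/-- `Ann(𝔪²)`, as a `k`-subspace of `G(A_n)`. -/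
def annMaxSq (k : Type*) [Field k] (m : ℕ) : Submodule k (GA k m) :=
  Submodule.restrictScalars k (Submodule.annihilator (maxIdeal k m ^ 2))

/-! ## Tableaux, tabloids and Specht modules

A shape is given by its sequence of positive row lengths, a `Composition n` (for a partition this
sequence is weakly decreasing). The boxes are numbered from left to right and from top to bottom,
so that a box is an element of `Fin n`. Everything is numbered from `0`. -/

/-- The row of the box `i`. -/
def boxRow {n : ℕ} (μ : Composition n) (i : Fin n) : ℕ := μ.index i

/-- The column of the box `i`. -/
def boxCol {n : ℕ} (μ : Composition n) (i : Fin n) : ℕ := μ.invEmbedding i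

/-- Row equivalence of tableaux of shape `μ`. A tableau is a bijection `t`, with `t i` the label of
the box `i`; two are equivalent if each label is in the same row of both. -/
def rowSetoid {n : ℕ} (μ : Composition n) : Setoid (Equiv.Perm (Fin n)) where
  r t t' := ∀ j, boxRow μ (t.symm j) = boxRow μ (t'.symm j)
  iseqv := ⟨fun _ _ => rfl, fun h j => (h j).symm, fun h h' j => (h j).trans (h' j)⟩

/-- Tabloids of shape `μ`. -/
def Tabloid {n : ℕ} (μ : Composition n) : Type := Quotient (rowSetoid μ)

/-- The tabloid `{t}` of a tableau `t`; it equals `t · {t_μ}`, where `t_μ(i) = i` and a permutation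
acts on tableaux by permuting the labels. -/
def Tabloid.mk {n : ℕ} (μ : Composition n) (t : Equiv.Perm (Fin n)) : Tabloid μ :=
  Quotient.mk (rowSetoid μ) t

/-- The permutation module `M_μ`, with basis the tabloids of shape `μ`. -/
abbrev PermModule (k : Type*) [Field k] {n : ℕ} (μ : Composition n) : Type _ := Tabloid μ →₀ k

open Classical in
/-- The column stabilizer `C_t` of a tableau `t`: the permutations of the labels that keep each
label in its column of `t`. -/
def colStabilizer {n : ℕ} (μ : Composition n) (t : Equiv.Perm (Fin n)) :
    Finset (Equiv.Perm (Fin n)) :=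
  {π | ∀ j, boxCol μ (t.symm (π j)) = boxCol μ (t.symm j)}

/-- The polytabloid `e_t = ∑_{π ∈ C_t} sgn(π) π{t}`. -/
def polytabloid (k : Type*) [Field k] {n : ℕ} (μ : Composition n) (t : Equiv.Perm (Fin n)) :
    PermModule k μ :=
  ∑ π ∈ colStabilizer μ t,
    Finsupp.single (Tabloid.mk μ (π * t)) (((Equiv.Perm.sign π : ℤˣ) : ℤ) : k)

/-- The Specht module `V_μ ⊆ M_μ`, spanned by the polytabloids. -/
def specht (k : Type*) [Field k] {n : ℕ} (μ : Composition n) : Submodule k (PermModule k μ) :=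
  Submodule.span k (Set.range (polytabloid k μ))

/-- A generalized tableau `T` of shape `μ` (with `T i` the label of the box `i`) has content `c` if
each label `s` occurs exactly `c s` times. -/
def HasContent {n : ℕ} (T : Fin n → Fin n) (c : Fin n → ℕ) : Prop :=
  ∀ s, (Finset.univ.filter fun i => T i = s).card = c s

/-- Semi-standard: weakly increasing along rows and strictly increasing down columns. -/
def IsSemistandard {n : ℕ} (μ : Composition n) (T : Fin n → Fin n) : Prop :=
  (∀ i j, boxRow μ i = boxRow μ j → boxCol μ i ≤ boxCol μ j → T i ≤ T j) ∧
  (∀ i j, boxCol μ i = boxCol μ j → boxRow μ i < boxRow μ j → T i < T j)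

open Classical in
/-- The generalized tableaux `S` that are row equivalent to `T`, i.e. those that arise from `T` by
permuting the labels within each row. Each such `S` is listed once. -/
def rowClass {n : ℕ} (μ : Composition n) (T : Fin n → Fin n) : Finset (Fin n → Fin n) :=
  {S | ∃ ρ : Equiv.Perm (Fin n), (∀ i, boxRow μ (ρ i) = boxRow μ i) ∧ S = T ∘ ρ}

/-! ## The maps `θ_{T,σ}` -/

/-- The factor `x_{s-1,j}` (labels numbered from `1`) with the convention `x_{0,j} = 1`. With labels
numbered from `0`, the label `0` gives `1` and the label `i + 1` gives the variable `x_{i,j}`. -/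
def labelVar (k : Type*) [Field k] (m : ℕ) (s j : Fin (m + 1)) : GA k m :=
  Fin.cases (motive := fun _ => GA k m) 1 (fun i => xVar k m i j) s

/-- `t · α(S)`, where `α(S) = ∏_i x_{S(i)-1,i}` and the permutation `t` acts on `G(A_n)` by
`x_{i,j} ↦ x_{i,t(j)}`. -/
def alphaAt (k : Type*) [Field k] (m : ℕ) (S : Fin (m + 1) → Fin (m + 1))
    (t : Equiv.Perm (Fin (m + 1))) : GA k m :=
  ∏ i, labelVar k m (S i) (t i)

/-- `t · ∑_{S ∼ U} α(S)`, the sum being over the tableaux `S` that are row equivalent to `U`. -/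
def rowSum (k : Type*) [Field k] (m : ℕ) (μ : Composition (m + 1))
    (U : Fin (m + 1) → Fin (m + 1)) (t : Equiv.Perm (Fin (m + 1))) : GA k m :=
  ∑ S ∈ rowClass μ U, alphaAt k m S t

theorem rowSum_congr (k : Type*) [Field k] (m : ℕ) (μ : Composition (m + 1))
    (U : Fin (m + 1) → Fin (m + 1)) (t t' : Equiv.Perm (Fin (m + 1)))
    (h : (rowSetoid μ).r t t') : rowSum k m μ U t = rowSum k m μ U t' := by
  classical
  have h1 : ∀ i, boxRow μ (t.symm (t' i)) = boxRow μ i := fun i => by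
    simpa using h (t' i)
  have h2 : ∀ i, boxRow μ (t'.symm (t i)) = boxRow μ i := fun i => by
    simpa using (h (t i)).symm
  unfold rowSum
  refine Finset.sum_bij' (fun S _ => S ∘ fun i => t.symm (t' i))
    (fun S _ => S ∘ fun i => t'.symm (t i)) ?_ ?_ ?_ ?_ ?_
  · intro S hS
    simp only [rowClass, Finset.mem_filter, Finset.mem_univ, true_and] at hS ⊢
    obtain ⟨ρ, hρ, rfl⟩ := hS
    exact ⟨(t'.trans t.symm).trans ρ, fun i => by simp [hρ, h1], by ext i; simp⟩
  · intro S hS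
    simp only [rowClass, Finset.mem_filter, Finset.mem_univ, true_and] at hS ⊢
    obtain ⟨ρ, hρ, rfl⟩ := hS
    exact ⟨(t.trans t'.symm).trans ρ, fun i => by simp [hρ, h2], by ext i; simp⟩
  · intro S _; funext i; simp
  · intro S _; funext i; simp
  · intro S _
    unfold alphaAt
    rw [← Equiv.prod_comp (t'.trans t.symm)]
    simp

/-- The `S_n`-equivariant map `θ_{T,σ} : M_μ → G(A_n)` with
`θ_{T,σ}({t_μ}) = ∑_{S ∼ σ⁻¹T} α(S)`, where `(σ⁻¹T)(i) = σ⁻¹(T(i))`; on the basis it is given by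
`{t} = t · {t_μ} ↦ t · ∑_{S ∼ σ⁻¹T} α(S)`. -/
def theta (k : Type*) [Field k] (m : ℕ) (μ : Composition (m + 1))
    (T : Fin (m + 1) → Fin (m + 1)) (σ : Equiv.Perm (Fin (m + 1))) :
    PermModule k μ →ₗ[k] GA k m :=
  Finsupp.linearCombination k
    (Quotient.lift (rowSum k m μ (fun i => σ⁻¹ (T i)))
      (rowSum_congr k m μ (fun i => σ⁻¹ (T i))) : Tabloid μ → GA k m)

/-! ## Partitions attached to a multidegree, and the shape `(D, D - 1)` -/

/-- The ordered partition `a = (n - ∑ d_i, d_1, …, d_{n-1})` associated to `d`, for `n = m + 1`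
and `∑ d_i ≤ n`. -/
def orderedPartition {m : ℕ} (d : Fin m → ℕ) : Fin (m + 1) → ℕ :=
  Fin.cons (m + 1 - ∑ i, d i) d

/-- `D = ⌈n/2⌉`. -/
def halfCeil (n : ℕ) : ℕ := ⌈(n : ℚ) / 2⌉₊

theorem halfCeil_odd (n : ℕ) (h : Odd n) : 2 * halfCeil n = n + 1 := by
  obtain ⟨q, rfl⟩ := h
  have : halfCeil (2 * q + 1) = q + 1 := by
    unfold halfCeil
    rw [Nat.ceil_eq_iff (by omega)]
    push_cast
    constructor <;> linarith
  omega

/-- The partition `ε = (D, D - 1)` of an odd number `n ≥ 4`. -/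
def epsilonShape (n : ℕ) (hn : 4 ≤ n) (hodd : Odd n) : Composition n where
  blocks := [halfCeil n, halfCeil n - 1]
  blocks_pos := by
    have := halfCeil_odd n hodd
    intro i hi
    simp only [List.mem_cons, List.not_mem_nil, or_false] at hi
    omega
  blocks_sum := by
    have := halfCeil_odd n hodd
    simp only [List.sum_cons, List.sum_nil]
    omega

end

/-! Let `s = ∑ d_i` and give `s` slots the labels `ℓ`, each `i` used `d_i` times. The piece of
multidegree `d` is spanned by the monomials `X(R) = ∏ x_{ℓ c, R c}`, where `R` places the slots at
the `n` positions. As a function of `R`, `X` is admissible: it vanishes at non-injective `R`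
(`x_{i,j} x_{i',j} = 0`) and sums to zero over each argument (`∑_j x_{i,j} = 0`). In characteristic
`0` these relations suffice: by Newton's identities the linear sums generate the whole ideal
(`galoisClosureIdeal_le_sumIdeal`), so every scalar admissible function defines a linear functional
on `G(A_n)` (`tensorFunctional_eq_zero`).

Let `f = ∑ g(R) X(R)` be killed by `𝔪²`. Multiply `f` by `x_{y,u} x_{z,v}` with two labels `y`, `z`
not used by `ℓ`, and apply these functionals. After symmetrizing `g` to `h`, one finds that `h` is
orthogonal to `φ(·, u, v)` for every admissible `φ` on `s + 2` slots
(`exists_symmetrized_coefficients`). Suitable `φ` are products of a determinant (a column containing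
`u` and `v`) and differences `δ_p - δ_q`. If `2s + 2 ≤ n`, they give `h ⊥ chi p q` for all disjoint
injective `p`, `q`. If only `2s + 1 ≤ n`, a sum of two `3 × 3` determinants shows that the pairing
of `h` with `chi p q` is unchanged when the pairs `(p i, q i)` are permuted.

The bridge back to `f` is that the functions `chi p q` detect everything admissible functions see
when `2s ≤ n`: `sum_disjointPairs` turns the pairings of a function with the `chi p q` into the
operator `symOp`, which is positive definite over `ℚ`, hence injective. Thus `h ⊥ chi` forces `f =
0` (`sum_smul_eq_zero_of_chi_orth`), and the symmetric case puts `f` in the span of the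
symmetrizations of `∑_r chi p q r • X r` (`sum_smul_mem_span_of_chi_symm`). For `n = 2s + 1` these
are, up to a nonzero integer, the images of polytabloids of shape `(s + 1, s)` under `θ_{T,σ}`, with
`T` the tableau whose top row is constant (`card_smul_theta_polytabloid`). -/

open scoped TensorProduct

noncomputable section

open Finset

/-! ### Admissible functions, and the operator obtained from pairing with `chi`. -/

section SlotFunctions

set_option linter.unusedSectionVars false

variable {ι α : Type*} [Fintype ι] [DecidableEq ι] [Fintype α] [DecidableEq α]
variable {V : Type*} [AddCommGroup V]

/-- Functions of `r : ι → α` that vanish at non-injective `r` and whose sum over each single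
argument is zero. -/
def IsAdmissible (X : (ι → α) → V) : Prop :=
  (∀ r, ¬ Function.Injective r → X r = 0) ∧ ∀ i r, ∑ a, X (Function.update r i a) = 0

theorem IsAdmissible.comp_perm {X : (ι → α) → V} (hX : IsAdmissible X) (τ : Equiv.Perm ι) :
    IsAdmissible fun r => X (r ∘ τ) := by
  refine ⟨fun r hr => hX.1 _ fun h => hr ?_, fun i r => ?_⟩
  · exact (Function.Injective.of_comp_iff' r τ.bijective).1 h
  · have := hX.2 (τ.symm i) (r ∘ τ)
    rw [← this]
    refine sum_congr rfl fun a _ => congrArg X ?_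
    conv_lhs => rw [← τ.apply_symm_apply i]
    exact Function.update_comp_eq_of_injective r τ.injective _ a

/-- A box that is unrestricted in direction `i` is a disjoint union of full lines in that direction,
and `X` sums to zero on each. -/
theorem sum_piFinset_update_univ {X : (ι → α) → V} {i : ι}
    (hX : ∀ r, ∑ a, X (Function.update r i a) = 0) (S : ι → Finset α) :
    ∑ p ∈ Fintype.piFinset (Function.update S i univ), X p = 0 := by
  rcases isEmpty_or_nonempty α with h | ⟨⟨a₀⟩⟩
  · exact sum_eq_zero fun p _ => (h.elim (p i))
  -- Freezing coordinate `i` at an arbitrary `a₀` selects one representative of each line.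
  · have : ∑ x ∈ Fintype.piFinset (Function.update S i {a₀}) ×ˢ (univ : Finset α),
        X (Function.update x.1 i x.2) = ∑ p ∈ Fintype.piFinset (Function.update S i univ), X p := by
      refine sum_bij' (fun x _ => Function.update x.1 i x.2)
        (fun p _ => (Function.update p i a₀, p i)) ?_ ?_ ?_ ?_ ?_
      · rintro ⟨p, a⟩ hx
        simp only [mem_product, Fintype.mem_piFinset, mem_univ, and_true] at hx ⊢
        intro j
        rcases eq_or_ne j i with rfl | hj
        · simp
        · simpa [hj] using hx j
      · intro p hp
        simp only [mem_product, Fintype.mem_piFinset, mem_univ, and_true] at hp ⊢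
        intro j
        rcases eq_or_ne j i with rfl | hj
        · simp
        · simpa [hj] using hp j
      · rintro ⟨p, a⟩ hx
        simp only [mem_product, Fintype.mem_piFinset, mem_univ, and_true] at hx
        have := hx i
        simp only [Function.update_self, mem_singleton] at this
        simp [← this]
      · intro p hp
        simp
      · intro p hp
        rfl
    rw [← this, sum_product]
    exact sum_eq_zero fun p _ => hX p

theorem sum_eq_zero_of_sum_update {X : (ι → α) → V} {i : ι}
    (hX : ∀ r, ∑ a, X (Function.update r i a) = 0) : ∑ r, X r = 0 := by
  have := sum_piFinset_update_univ hX fun _ => univ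
  rwa [Function.update_eq_self_iff.2 rfl, Fintype.piFinset_univ] at this

theorem piFinset_update_union (S : ι → Finset α) (i : ι) (B : Finset α) (X : (ι → α) → V) :
    ∑ p ∈ Fintype.piFinset (Function.update S i Bᶜ), X p +
      ∑ p ∈ Fintype.piFinset (Function.update S i B), X p =
    ∑ p ∈ Fintype.piFinset (Function.update S i univ), X p := by
  rw [← sum_union]
  · refine sum_congr ?_ fun _ _ => rfl
    ext p
    simp only [mem_union, Fintype.mem_piFinset]
    constructor
    · rintro (h | h) j
      · rcases eq_or_ne j i with rfl | hj
        · simp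
        · simpa [hj] using h j
      · rcases eq_or_ne j i with rfl | hj
        · simp
        · simpa [hj] using h j
    · intro h
      by_cases hp : p i ∈ B
      · right
        intro j
        rcases eq_or_ne j i with rfl | hj
        · simpa using hp
        · simpa [hj] using h j
      · left
        intro j
        rcases eq_or_ne j i with rfl | hj
        · simpa using hp
        · simpa [hj] using h j
  · rw [Finset.disjoint_left]
    intro p h1 h2
    simp only [Fintype.mem_piFinset] at h1 h2
    have h1 := h1 i
    have h2 := h2 i
    simp only [Function.update_self, mem_compl] at h1 h2
    exact h1 h2

/-- In one coordinate, the sums over `B` and over `Bᶜ` add up to zero, so each exchange of the two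
costs a sign; induction on the set of coordinates. -/
theorem IsAdmissible.sum_compl {X : (ι → α) → V} (hX : IsAdmissible X) (B : Finset α)
    (I : Finset ι) : ∀ S : ι → Finset α,
    ∑ p ∈ Fintype.piFinset (I.piecewise (fun _ => Bᶜ) S), X p =
      (-1 : ℤ) ^ I.card • ∑ p ∈ Fintype.piFinset (I.piecewise (fun _ => B) S), X p := by
  induction I using Finset.induction_on with
  | empty => intro S; simp
  | insert i I hi ih =>
    intro S
    have key : ∀ C : Finset α, (insert i I).piecewise (fun _ => C) S =
        Function.update (I.piecewise (fun _ => C) S) i C := fun C => by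
      rw [piecewise_insert]
    have key2 : ∀ C C' : Finset α, I.piecewise (fun _ => C) (Function.update S i C') =
        Function.update (I.piecewise (fun _ => C) S) i C' := fun C C' => by
      ext1 j
      rcases eq_or_ne j i with rfl | hj
      · simp [hi]
      · by_cases hjI : j ∈ I <;> simp [hj, hjI]
    rw [key, ← key2, ih, key2, key, card_insert_of_notMem hi, pow_succ]
    have := piFinset_update_union (I.piecewise (fun _ => B) S) i B X
    rw [sum_piFinset_update_univ (hX.2 i), add_eq_zero_iff_eq_neg] at this
    rw [this]
    simp

/-- The permutations that fix every element outside `I`. -/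
def fixOff (I : Finset ι) : Finset (Equiv.Perm ι) := {τ | ∀ i, i ∉ I → τ i = i}

theorem mem_fixOff {I : Finset ι} {τ : Equiv.Perm ι} : τ ∈ fixOff I ↔ ∀ i, i ∉ I → τ i = i := by
  simp [fixOff]

theorem inv_mem_fixOff {I : Finset ι} {τ : Equiv.Perm ι} (h : τ ∈ fixOff I) : τ⁻¹ ∈ fixOff I := by
  rw [mem_fixOff] at h ⊢
  intro i hi
  rw [Equiv.Perm.inv_eq_iff_eq, h i hi]

theorem mul_mem_fixOff {I : Finset ι} {τ τ' : Equiv.Perm ι} (h : τ ∈ fixOff I)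
    (h' : τ' ∈ fixOff I) : τ * τ' ∈ fixOff I := by
  rw [mem_fixOff] at h h' ⊢
  intro i hi
  rw [Equiv.Perm.mul_apply, h' i hi, h i hi]

/-- An injective function with values in the range of `r` that agrees with `r` off `I` is `r ∘ τ`
for a unique `τ` fixing the complement of `I`; the other terms vanish. -/
theorem sum_fixOff (I : Finset ι) (r : ι → α) (hr : Function.Injective r) (X : (ι → α) → V)
    (hX : ∀ r, ¬ Function.Injective r → X r = 0) :
    ∑ p ∈ Fintype.piFinset (I.piecewise (fun _ => univ.image r) fun i => {r i}), X p =
      ∑ τ ∈ fixOff I, X (r ∘ τ) := by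
  symm
  refine sum_bij_ne_zero (fun τ _ _ => r ∘ τ) ?_ ?_ ?_ ?_
  · intro τ hτ _
    rw [mem_fixOff] at hτ
    rw [Fintype.mem_piFinset]
    intro i
    by_cases hi : i ∈ I
    · simp [hi]
    · simp [hi, hτ i hi]
  · intro τ _ _ τ' _ _ h
    ext i
    exact hr (congrFun h i)
  · intro p hp hne
    have hpi : Function.Injective p := by
      by_contra h
      exact hne (hX p h)
    rw [Fintype.mem_piFinset] at hp
    have hex : ∀ i, ∃ j, r j = p i := by
      intro i
      have := hp i
      by_cases hi : i ∈ I
      · simpa [hi] using this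
      · exact ⟨i, by simpa [hi, eq_comm] using this⟩
    choose t ht using hex
    have hti : Function.Injective t := fun i j h => hpi (by rw [← ht, ← ht, h])
    have hpt : p = r ∘ (Equiv.ofBijective t (Finite.injective_iff_bijective.1 hti)) := by
      ext1 i
      simp [ht]
    refine ⟨Equiv.ofBijective t (Finite.injective_iff_bijective.1 hti), ?_, ?_, hpt.symm⟩
    · rw [mem_fixOff]
      intro i hi
      have := hp i
      simp only [hi, not_false_eq_true, piecewise_eq_of_notMem, mem_singleton] at this
      apply hr
      rw [← this]
      exact ht i
    · rwa [← hpt]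
  · intro τ _ _
    rfl

/-- The number of injective extensions counted in `card_extensions`. -/
def extensionCount (ι α : Type*) [Fintype ι] [Fintype α] (I : Finset ι) : ℕ :=
  (Fintype.card α - Fintype.card ι - I.card).descFactorial (Fintype.card ι - I.card)

/-- Only the values of `q` off `I` are free. They are distinct and avoid the `card ι` values of `p`
and the `card I` values of `r` on `I`. -/
theorem card_extensions (I : Finset ι) (p r : ι → α) (hp : Function.Injective p)
    (hr : Function.Injective r) (hd : ∀ i ∈ I, ∀ j, r i ≠ p j) :
    (univ.filter fun q : ι → α => Function.Injective (Sum.elim p q) ∧ ∀ i ∈ I, q i = r i).card =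
      extensionCount ι α I := by
  classical
  set T : Finset α := (univ.image p ∪ I.image r)ᶜ with hT
  have hTcard : T.card = Fintype.card α - Fintype.card ι - I.card := by
    rw [hT, card_compl, card_union_of_disjoint, card_image_of_injective _ hp,
      card_image_of_injective _ hr, card_univ, Nat.sub_sub]
    rw [Finset.disjoint_left]
    intro a h1 h2
    simp only [mem_image, mem_univ, true_and] at h1 h2
    obtain ⟨j, rfl⟩ := h1
    obtain ⟨i, hi, h⟩ := h2
    exact hd i hi j h
  have hTmem : ∀ a, a ∈ T ↔ (∀ j, p j ≠ a) ∧ ∀ i ∈ I, r i ≠ a := by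
    intro a
    simp [hT]
  have hI : Fintype.card {i // i ∉ I} = Fintype.card ι - I.card := by
    rw [Fintype.card_subtype_compl, Fintype.card_coe]
  have hc : Fintype.card ({i // i ∉ I} ↪ T) = extensionCount ι α I := by
    rw [Fintype.card_embedding_eq, hI, Fintype.card_coe, hTcard, extensionCount]
  rw [← hc, ← Finset.card_univ]
  symm
  refine card_bij (fun e _ => fun i => if h : i ∈ I then r i else (e ⟨i, h⟩ : α)) ?_ ?_ ?_
  · intro e _
    have he : ∀ i, (∀ j, p j ≠ e i) ∧ ∀ j ∈ I, r j ≠ e i := fun i => (hTmem _).1 (e i).2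
    simp only [mem_filter, mem_univ, true_and]
    refine ⟨hp.sumElim ?_ ?_, fun i hi => by simp [hi]⟩
    · intro i j hij
      by_cases hi : i ∈ I <;> by_cases hj : j ∈ I <;> simp only [hi, hj, dif_pos, dif_neg,
        not_false_eq_true] at hij
      · exact hr hij
      · exact absurd hij ((he _).2 i hi)
      · exact absurd hij.symm ((he _).2 j hj)
      · have := e.injective (Subtype.ext hij)
        exact congrArg Subtype.val this
    · intro j i
      by_cases hi : i ∈ I
      · simpa [hi] using (hd i hi j).symm
      · simpa [hi] using (he ⟨i, hi⟩).1 j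
  · intro e _ e' _ h
    ext ⟨i, hi⟩
    have := congrFun h i
    simpa [hi] using this
  · intro q hq
    simp only [mem_filter, mem_univ, true_and] at hq
    obtain ⟨hq, hqI⟩ := hq
    have hqi : Function.Injective q := hq.comp Sum.inr_injective
    have hpq : ∀ i j, p i ≠ q j := fun i j h => by
      have := @hq (Sum.inl i) (Sum.inr j) h
      simp at this
    refine ⟨⟨fun i => ⟨q i, (hTmem _).2 ⟨fun j => hpq j i, fun j hj h => ?_⟩⟩, ?_⟩,
      mem_univ _, ?_⟩
    · rw [← hqI j hj] at h
      have := hqi h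
      exact i.2 (this ▸ hj)
    · intro i j h
      exact Subtype.ext (hqi (congrArg Subtype.val h))
    · ext1 i
      by_cases hi : i ∈ I
      · simp [hi, hqI i hi]
      · simp only [hi, dif_neg, not_false_eq_true]
        rfl

variable (k : Type*) [Field k]

/-- `∏ i, (δ_{p i} - δ_{q i})`, as a function of `r`. -/
def chi (p q r : ι → α) : k :=
  ∏ i, ((if r i = p i then 1 else 0) - (if r i = q i then 1 else 0))

theorem chi_eq_sum (p q r : ι → α) :
    chi k p q r = ∑ I : Finset ι, (-1) ^ I.card * if r = I.piecewise q p then 1 else 0 := by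
  rw [chi, Finset.prod_sub, powerset_univ]
  refine sum_congr rfl fun I _ => ?_
  rw [mul_assoc]
  congr 1
  rw [Finset.prod_ite_zero, Finset.prod_ite_zero]
  by_cases h : r = I.piecewise q p
  · rw [if_pos, if_pos, if_pos h]
    · simp
    · intro i hi
      rw [h, piecewise_eq_of_mem _ _ _ hi]
    · intro i hi
      rw [h, piecewise_eq_of_notMem _ _ _ (by simpa using hi)]
  · rw [if_neg h]
    by_cases h1 : ∀ i ∈ univ \ I, r i = p i
    · rw [if_neg (c := ∀ i ∈ I, r i = q i), mul_zero]
      intro h2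
      apply h
      ext1 i
      by_cases hi : i ∈ I
      · rw [piecewise_eq_of_mem _ _ _ hi, h2 i hi]
      · rw [piecewise_eq_of_notMem _ _ _ hi, h1 i (by simpa using hi)]
    · rw [if_neg h1, zero_mul]

theorem sum_chi_smul [Module k V] (p q : ι → α) (X : (ι → α) → V) :
    ∑ r, chi k p q r • X r = ∑ I : Finset ι, (-1 : k) ^ I.card • X (I.piecewise q p) := by
  simp only [chi_eq_sum, sum_smul, mul_smul, ite_smul, one_smul, zero_smul]
  rw [sum_comm]
  refine sum_congr rfl fun I _ => ?_
  rw [← smul_sum]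
  simp

/-- The pairs of injective functions with disjoint ranges. -/
def disjointPairs (ι α : Type*) [Fintype ι] [DecidableEq ι] [Fintype α] [DecidableEq α] :
    Finset ((ι → α) × (ι → α)) := {x | Function.Injective (Sum.elim x.1 x.2)}

/-- A weighted sum of symmetrizers over the arguments. -/
def symOp : ((ι → α) → k) →ₗ[k] ((ι → α) → k) where
  toFun f r := ∑ I : Finset ι, (extensionCount ι α I : k) * ∑ τ ∈ fixOff I, f (r ∘ τ)
  map_add' f g := by
    ext r
    simp [sum_add_distrib, mul_add]
  map_smul' c f := by
    ext r
    simp only [Pi.smul_apply, smul_eq_mul, RingHom.id_apply, mul_sum]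
    exact sum_congr rfl fun I _ => sum_congr rfl fun τ _ => by ring

theorem symOp_apply (f : (ι → α) → k) (r : ι → α) : symOp k f r =
    ∑ I : Finset ι, (extensionCount ι α I : k) * ∑ τ ∈ fixOff I, f (r ∘ τ) := rfl

theorem sum_comp_perm {M : Type*} [AddCommMonoid M] (τ : Equiv.Perm ι) (F : (ι → α) → M) :
    ∑ r, F (r ∘ τ) = ∑ r, F r :=
  Equiv.sum_comp (Equiv.arrowCongr τ.symm (Equiv.refl α)) F

variable {k}

theorem sum_symOp_smul [Module k V] (f : (ι → α) → k) (X : (ι → α) → V) :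
    ∑ r, symOp k f r • X r =
      ∑ I : Finset ι, (extensionCount ι α I : k) • ∑ r, f r • ∑ τ ∈ fixOff I, X (r ∘ τ) := by
  simp only [symOp_apply, sum_smul, mul_smul]
  rw [sum_comm]
  refine sum_congr rfl fun I _ => ?_
  rw [← smul_sum]
  congr 1
  simp only [smul_sum]
  rw [sum_comm, sum_comm (s := univ) 
    (f := fun r (τ : Equiv.Perm ι) => f r • X (r ∘ τ))]
  refine sum_bij' (fun τ _ => τ⁻¹) (fun τ _ => τ⁻¹) (fun τ h => inv_mem_fixOff h)
    (fun τ h => inv_mem_fixOff h) (fun τ _ => inv_inv τ) (fun τ _ => inv_inv τ) ?_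
  intro τ _
  rw [← sum_comp_perm τ fun r => f r • X (r ∘ (τ⁻¹ : Equiv.Perm ι))]
  refine sum_congr rfl fun r _ => ?_
  congr 2
  ext i
  simp

/-- Expand `chi` over subsets `I` and collect the terms with `I.piecewise q p = r`. The number of
possible `q` depends only on `I`, while `p` equals `r` off `I` and avoids the range of `r` on `I`.
Admissibility trades "avoids the range" for "lies in the range", which leaves the permutations of
`r` within `I`. -/
theorem sum_disjointPairs [Module k V] (f : (ι → α) → k) {X : (ι → α) → V}
    (hX : IsAdmissible X) :
    ∑ x ∈ disjointPairs ι α, (∑ r, chi k x.1 x.2 r * f r) • X x.1 =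
      ∑ r, symOp k f r • X r := by
  have h1 : ∀ x : (ι → α) × (ι → α), (∑ r, chi k x.1 x.2 r * f r) • X x.1 =
      ∑ I : Finset ι, (-1 : k) ^ I.card • f (I.piecewise x.2 x.1) • X x.1 := by
    intro x
    have := sum_chi_smul k x.1 x.2 f
    simp only [smul_eq_mul] at this
    rw [this, sum_smul]
    simp only [mul_smul]
  simp only [h1]
  rw [sum_comm, sum_symOp_smul]
  refine sum_congr rfl fun I _ => ?_
  rw [← smul_sum]
  have h2 : ∑ x ∈ disjointPairs ι α, f (I.piecewise x.2 x.1) • X x.1 =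
      ∑ r, f r • ∑ p, ((univ.filter fun q : ι → α => Function.Injective (Sum.elim p q) ∧
        I.piecewise q p = r).card : k) • X p := by
    rw [disjointPairs, sum_filter, ← univ_product_univ, sum_product]
    simp only [smul_sum]
    rw [sum_comm (s := univ) (t := univ) (f := fun r p => f r • _ • X p)]
    refine sum_congr rfl fun p _ => ?_
    simp only [card_filter, Nat.cast_sum, sum_smul, smul_sum]
    rw [sum_comm]
    refine sum_congr rfl fun q _ => ?_
    by_cases hpq : Function.Injective (Sum.elim p q)
    · simp [hpq]
    · simp [hpq]
  rw [h2, smul_sum, smul_sum]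
  refine sum_congr rfl fun r _ => ?_
  rw [smul_comm, smul_comm _ (f r)]
  congr 1
  by_cases hr : Function.Injective r
  · have h3 : ∀ p, ((univ.filter fun q : ι → α => Function.Injective (Sum.elim p q) ∧
        I.piecewise q p = r).card : k) • X p =
        (extensionCount ι α I : k) • if p ∈ Fintype.piFinset
          (I.piecewise (fun _ => (univ.image r)ᶜ) fun i => {r i}) then X p else 0 := by
      intro p
      by_cases hp : Function.Injective p
      · split_ifs with hmem
        · rw [Fintype.mem_piFinset] at hmem
          have hoff : ∀ i, i ∉ I → p i = r i := fun i hi => by simpa [hi] using hmem i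
          have hon : ∀ i ∈ I, ∀ j, r j ≠ p i := fun i hi => by simpa [hi] using hmem i
          rw [← card_extensions I p r hp hr]
          · congr 3
            ext q
            simp only [mem_filter, mem_univ, true_and, and_congr_right_iff]
            intro _
            constructor
            · rintro h i hi
              rw [← h, piecewise_eq_of_mem _ _ _ hi]
            · intro h
              ext1 i
              by_cases hi : i ∈ I
              · rw [piecewise_eq_of_mem _ _ _ hi, h i hi]
              · rw [piecewise_eq_of_notMem _ _ _ hi, hoff i hi]
          · intro i hi j
            by_cases hj : j ∈ I
            · exact hon j hj i
            · rw [hoff j hj]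
              intro h
              exact hj (hr h ▸ hi)
        · rw [smul_zero]
          convert zero_smul k (X p)
          rw [filter_eq_empty_iff.2, card_empty, Nat.cast_zero]
          rintro q _ ⟨hq, rfl⟩
          apply hmem
          rw [Fintype.mem_piFinset]
          intro i
          by_cases hi : i ∈ I
          · simp only [hi, piecewise_eq_of_mem, mem_compl, mem_image, mem_univ, true_and,
              not_exists]
            intro j
            by_cases hj : j ∈ I
            · simp only [hj, piecewise_eq_of_mem]
              intro h
              have := @hq (Sum.inr j) (Sum.inl i) h
              simp at this
            · simp only [hj, not_false_eq_true, piecewise_eq_of_notMem]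
              intro h
              exact hj (hp h ▸ hi)
          · simp [hi]
      · simp [hX.1 p hp]
    simp only [h3]
    -- The sign from `sum_compl` cancels the sign with which `I` occurs in `chi`, so all
    -- coefficients of `symOp` are nonnegative.
    rw [← smul_sum, ← sum_filter, filter_mem_eq_inter, univ_inter, hX.sum_compl,
      sum_fixOff I r hr X hX.1, smul_comm]
    congr 1
    rw [← Int.cast_smul_eq_zsmul k, smul_smul]
    push_cast
    rw [← mul_pow]
    simp
  · rw [sum_eq_zero, sum_eq_zero (s := fixOff I), smul_zero, smul_zero]
    · intro τ _
      exact hX.1 _ fun h => hr ((Function.Injective.of_comp_iff' r τ.bijective).1 h)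
    · intro p _
      convert zero_smul k (X p)
      rw [filter_eq_empty_iff.2, card_empty, Nat.cast_zero]
      rintro q _ ⟨hq, rfl⟩
      apply hr
      intro i j h
      have hp : Function.Injective p := hq.comp Sum.inl_injective
      have hq' : Function.Injective q := hq.comp Sum.inr_injective
      by_cases hi : i ∈ I <;> by_cases hj : j ∈ I <;> simp only [hi, hj, piecewise_eq_of_mem,
        not_false_eq_true, piecewise_eq_of_notMem] at h
      · exact hq' h
      · have := @hq (Sum.inr i) (Sum.inl j) h
        simp at this
      · have := @hq (Sum.inl i) (Sum.inr j) h
        simp at this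
      · exact hp h

end SlotFunctions

/-! ### Positivity of the operator `symOp` and its two consequences. -/

section SlotFunctions

set_option linter.unusedSectionVars false

variable {ι α : Type*} [Fintype ι] [DecidableEq ι] [Fintype α] [DecidableEq α]
variable {V : Type*} [AddCommGroup V] {k : Type*} [Field k]

/-- `fixOff I` is a group, so summing over it is a positive multiple of an orthogonal projection;
times the group order, the form is a sum of squares. -/
theorem sum_mul_sum_fixOff_nonneg (I : Finset ι) (f : (ι → α) → ℚ) :
    0 ≤ ∑ r, f r * ∑ τ ∈ fixOff I, f (r ∘ τ) := by
  have h1 : ∀ κ ∈ fixOff I, ∑ r, f r * ∑ τ ∈ fixOff I, f (r ∘ τ) =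
      ∑ r, f (r ∘ κ) * ∑ τ ∈ fixOff I, f (r ∘ τ) := by
    intro κ hκ
    rw [← sum_comp_perm κ]
    refine sum_congr rfl fun r _ => ?_
    congr 1
    refine sum_bij' (fun τ _ => κ * τ) (fun τ _ => κ⁻¹ * τ) (fun τ h => mul_mem_fixOff hκ h)
      (fun τ h => mul_mem_fixOff (inv_mem_fixOff hκ) h) ?_ ?_ ?_
    · intro τ _
      simp
    · intro τ _
      simp
    · intro τ _
      rfl
  have h2 : ((fixOff I).card : ℚ) * ∑ r, f r * ∑ τ ∈ fixOff I, f (r ∘ τ) =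
      ∑ r, (∑ τ ∈ fixOff I, f (r ∘ τ)) ^ 2 := by
    rw [← nsmul_eq_mul, ← sum_const, sum_congr rfl h1, sum_comm]
    refine sum_congr rfl fun r _ => ?_
    rw [← sum_mul, sq]
  have h3 : 0 < ((fixOff I).card : ℚ) := by
    rw [Nat.cast_pos, card_pos]
    exact ⟨1, by simp [mem_fixOff]⟩
  have h4 : 0 ≤ ((fixOff I).card : ℚ) * ∑ r, f r * ∑ τ ∈ fixOff I, f (r ∘ τ) := by
    rw [h2]
    exact sum_nonneg fun _ _ => sq_nonneg _
  exact nonneg_of_mul_nonneg_right h4 h3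

theorem extensionCount_empty_pos (h : 2 * Fintype.card ι ≤ Fintype.card α) :
    0 < extensionCount ι α ∅ := by
  rw [extensionCount, card_empty, Nat.pos_iff_ne_zero, Ne, Nat.descFactorial_eq_zero_iff_lt]
  omega

theorem fixOff_empty : fixOff (∅ : Finset ι) = {1} := by
  ext τ
  rw [mem_fixOff, mem_singleton, Equiv.ext_iff]
  simp

/-- All terms of the quadratic form of `symOp` are nonnegative, and the term `I = ∅` is a multiple
of `∑ f(r)²`, positive because `2 * card ι ≤ card α` leaves room for a disjoint `q`. -/
theorem symOp_rat_injective (h : 2 * Fintype.card ι ≤ Fintype.card α) (f : (ι → α) → ℚ)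
    (hf : symOp ℚ f = 0) : f = 0 := by
  have h1 : ∑ I : Finset ι, (extensionCount ι α I : ℚ) * ∑ r, f r * ∑ τ ∈ fixOff I, f (r ∘ τ) =
      0 := by
    have : ∑ r, f r * symOp ℚ f r = 0 := by simp [hf]
    rw [← this]
    simp only [symOp_apply, mul_sum]
    rw [sum_comm]
    exact sum_congr rfl fun r _ => sum_congr rfl fun I _ => sum_congr rfl fun τ _ => by ring
  rw [sum_eq_zero_iff_of_nonneg fun I _ => mul_nonneg (Nat.cast_nonneg _)
    (sum_mul_sum_fixOff_nonneg I f)] at h1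
  have h2 := h1 ∅ (mem_univ _)
  have h3 : (extensionCount ι α (∅ : Finset ι) : ℚ) ≠ 0 := by
    exact_mod_cast (extensionCount_empty_pos h).ne'
  rw [mul_eq_zero, or_iff_right h3, fixOff_empty] at h2
  simp only [sum_singleton, Equiv.Perm.coe_one, Function.comp_id] at h2
  rw [sum_eq_zero_iff_of_nonneg fun r _ => mul_self_nonneg _] at h2
  ext r
  exact mul_self_eq_zero.1 (h2 r (mem_univ _))

variable [CharZero k]

theorem symOp_injective (h : 2 * Fintype.card ι ≤ Fintype.card α) :
    Function.Injective (symOp (ι := ι) (α := α) k) := by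
  rw [injective_iff_map_eq_zero]
  intro f hf
  ext r
  -- The coefficients of `symOp` are natural numbers, so it commutes with every `ℚ`-linear
  -- functional `k → ℚ`, and these functionals separate the points of `k`.
  rw [Pi.zero_apply, ← Module.forall_dual_apply_eq_zero_iff ℚ]
  intro φ
  have : symOp ℚ (fun r => φ (f r)) = 0 := by
    ext r
    have h1 := congrArg φ (congrFun hf r)
    rw [symOp_apply, map_sum] at h1
    rw [symOp_apply, Pi.zero_apply]
    rw [Pi.zero_apply, map_zero] at h1
    rw [← h1]
    refine sum_congr rfl fun I _ => ?_
    rw [← nsmul_eq_mul, ← nsmul_eq_mul, map_nsmul, map_sum]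
  exact congrFun (symOp_rat_injective h _ this) r

/-- The functions orthogonal to all admissible functions with values in `V`. -/
def orthAdmissible (ι α k V : Type*) [Fintype ι] [DecidableEq ι] [Fintype α] [DecidableEq α]
    [AddCommGroup V] [Field k] [Module k V] : Submodule k ((ι → α) → k) where
  carrier := {f | ∀ X : (ι → α) → V, IsAdmissible X → ∑ r, f r • X r = 0}
  add_mem' := by
    intro f g hf hg X hX
    simp [add_smul, sum_add_distrib, hf X hX, hg X hX]
  zero_mem' := by
    intro X _
    simp
  smul_mem' := by
    intro c f hf X hX
    simp [mul_smul, ← smul_sum, hf X hX]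

variable [Module k V]

theorem symOp_mem_orthAdmissible {f : (ι → α) → k} (hf : f ∈ orthAdmissible ι α k V) :
    symOp k f ∈ orthAdmissible ι α k V := by
  intro X hX
  rw [sum_symOp_smul]
  refine sum_eq_zero fun I _ => ?_
  simp only [smul_sum]
  rw [sum_comm]
  refine sum_eq_zero fun τ _ => ?_
  rw [← smul_sum, hf _ (hX.comp_perm τ), smul_zero]

/-- An injective endomorphism that preserves a finite-dimensional subspace is bijective on it, so
nothing outside the subspace is mapped into it. -/
theorem mem_orthAdmissible_of_symOp (h : 2 * Fintype.card ι ≤ Fintype.card α)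
    {f : (ι → α) → k} (hf : symOp k f ∈ orthAdmissible ι α k V) :
    f ∈ orthAdmissible ι α k V := by
  let Z : orthAdmissible ι α k V →ₗ[k] orthAdmissible ι α k V :=
    (symOp k).restrict fun f hf => symOp_mem_orthAdmissible hf
  have hZ : Function.Injective Z := by
    intro x y hxy
    exact Subtype.ext (symOp_injective h (congrArg Subtype.val hxy))
  obtain ⟨g, hg⟩ := LinearMap.injective_iff_surjective.1 hZ ⟨_, hf⟩
  have := symOp_injective h (congrArg Subtype.val hg : symOp k g.1 = symOp k f)
  exact this ▸ g.2

/-- By `sum_disjointPairs`, `symOp f` is orthogonal to all admissible functions; hence so is `f`. -/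
theorem sum_smul_eq_zero_of_chi_orth (h : 2 * Fintype.card ι ≤ Fintype.card α)
    {f : (ι → α) → k} (hf : ∀ p q : ι → α, Function.Injective (Sum.elim p q) →
      ∑ r, chi k p q r * f r = 0) {X : (ι → α) → V} (hX : IsAdmissible X) :
    ∑ r, f r • X r = 0 := by
  refine mem_orthAdmissible_of_symOp h (f := f) ?_ X hX
  intro Y hY
  rw [← sum_disjointPairs f hY]
  refine sum_eq_zero fun x hx => ?_
  rw [disjointPairs, mem_filter] at hx
  rw [hf _ _ hx.2, zero_smul]

theorem chi_piecewise (I : Finset ι) (p q r : ι → α) :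
    chi k (I.piecewise q p) (I.piecewise p q) r = (-1) ^ I.card * chi k p q r := by
  rw [chi, chi, ← prod_const, ← univ_inter I, ← prod_ite_mem univ I, ← prod_mul_distrib,
    univ_inter]
  refine prod_congr rfl fun i _ => ?_
  by_cases hi : i ∈ I <;> simp [hi]

theorem chi_comp_perm (τ : Equiv.Perm ι) (p q r : ι → α) :
    chi k (p ∘ τ) (q ∘ τ) (r ∘ τ) = chi k p q r :=
  Equiv.prod_comp τ fun i => ((if r i = p i then 1 else 0) - (if r i = q i then 1 else 0) : k)

theorem injective_elim_comp_perm (τ : Equiv.Perm ι) {p q : ι → α}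
    (h : Function.Injective (Sum.elim p q)) : Function.Injective (Sum.elim (p ∘ τ) (q ∘ τ)) := by
  have : Sum.elim (p ∘ τ) (q ∘ τ) = Sum.elim p q ∘ Sum.map τ τ := by
    ext (i | i) <;> rfl
  rw [this]
  exact h.comp (τ.injective.sumMap τ.injective)

theorem injective_elim_piecewise (I : Finset ι) {p q : ι → α}
    (h : Function.Injective (Sum.elim p q)) :
    Function.Injective (Sum.elim (I.piecewise q p) (I.piecewise p q)) := by
  have : Sum.elim (I.piecewise q p) (I.piecewise p q) =
      Sum.elim p q ∘ fun x => if x.elim id id ∈ I then x.swap else x := by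
    ext (i | i) <;> by_cases hi : i ∈ I <;> simp [hi]
  rw [this]
  refine h.comp ?_
  rintro (i | i) (j | j) hij <;> by_cases hi : i ∈ I <;> by_cases hj : j ∈ I <;>
    simp_all

theorem sum_disjointPairs_piecewise {M : Type*} [AddCommMonoid M] (I : Finset ι)
    (F : (ι → α) × (ι → α) → M) :
    ∑ x ∈ disjointPairs ι α, F (I.piecewise x.2 x.1, I.piecewise x.1 x.2) =
      ∑ x ∈ disjointPairs ι α, F x := by
  have h : ∀ x ∈ disjointPairs ι α,
      (I.piecewise x.2 x.1, I.piecewise x.1 x.2) ∈ disjointPairs ι α := by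
    intro x hx
    rw [disjointPairs, mem_filter] at hx ⊢
    exact ⟨mem_univ _, injective_elim_piecewise I hx.2⟩
  have h' : ∀ x : (ι → α) × (ι → α), (I.piecewise (I.piecewise x.1 x.2) (I.piecewise x.2 x.1),
      I.piecewise (I.piecewise x.2 x.1) (I.piecewise x.1 x.2)) = x := by
    rintro ⟨p, q⟩
    ext i <;> by_cases hi : i ∈ I <;> simp [hi]
  exact sum_bij' (fun x _ => (I.piecewise x.2 x.1, I.piecewise x.1 x.2))
    (fun x _ => (I.piecewise x.2 x.1, I.piecewise x.1 x.2)) h h (fun x _ => h' x)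
    (fun x _ => h' x) fun x _ => rfl

theorem sum_disjointPairs_comp_perm {M : Type*} [AddCommMonoid M] (τ : Equiv.Perm ι)
    (F : (ι → α) × (ι → α) → M) :
    ∑ x ∈ disjointPairs ι α, F (x.1 ∘ τ, x.2 ∘ τ) = ∑ x ∈ disjointPairs ι α, F x := by
  have h : ∀ τ : Equiv.Perm ι, ∀ x ∈ disjointPairs ι α,
      (x.1 ∘ τ, x.2 ∘ τ) ∈ disjointPairs ι α := by
    intro τ x hx
    rw [disjointPairs, mem_filter] at hx ⊢
    exact ⟨mem_univ _, injective_elim_comp_perm τ hx.2⟩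
  refine sum_bij' (fun x _ => (x.1 ∘ τ, x.2 ∘ τ)) (fun x _ => (x.1 ∘ τ.symm, x.2 ∘ τ.symm))
    (h τ) (h τ.symm) ?_ ?_ fun x _ => rfl
  · rintro ⟨p, q⟩ _
    ext i <;> simp
  · rintro ⟨p, q⟩ _
    ext i <;> simp

/-- The function `θ`, a combination of symmetrized `chi`, is an eigenvector of `symOp` with
eigenvalue `N`. Up to functions orthogonal to all admissible ones, it equals `M • symOp f`, and
inverting `symOp` turns this into `(N * M) • f`. -/
theorem sum_smul_mem_span_of_chi_symm (h : 2 * Fintype.card ι ≤ Fintype.card α)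
    {f : (ι → α) → k} (hf : ∀ (p q : ι → α) (τ : Equiv.Perm ι),
      Function.Injective (Sum.elim p q) →
      ∑ r, chi k (p ∘ τ) (q ∘ τ) r * f r = ∑ r, chi k p q r * f r)
    {X : (ι → α) → V} (hX : IsAdmissible X) :
    ∑ r, f r • X r ∈ Submodule.span k {v | ∃ p q : ι → α, Function.Injective (Sum.elim p q) ∧
      v = ∑ τ : Equiv.Perm ι, ∑ r, chi k (p ∘ τ) (q ∘ τ) r • X r} := by
  set c : (ι → α) × (ι → α) → k := fun x => ∑ r, chi k x.1 x.2 r * f r with hc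
  set θ : (ι → α) → k := fun r => ∑ x ∈ disjointPairs ι α, c x *
    ∑ τ : Equiv.Perm ι, chi k (x.1 ∘ τ) (x.2 ∘ τ) r with hθ
  set N : k := ∑ I : Finset ι, (extensionCount ι α I : k) * ((fixOff I).card : k) with hN
  have hN0 : N ≠ 0 := by
    have : N = ((∑ I : Finset ι, extensionCount ι α I * (fixOff I).card : ℕ) : k) := by
      simp [hN]
    rw [this, Nat.cast_ne_zero]
    refine (lt_of_lt_of_le ?_ (single_le_sum (fun I _ => Nat.zero_le _) (mem_univ ∅))).ne'
    rw [fixOff_empty, card_singleton, mul_one]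
    exact extensionCount_empty_pos h
  have hθsum : ∀ Y : (ι → α) → V, ∑ r, θ r • Y r = ∑ x ∈ disjointPairs ι α, c x •
      ∑ τ : Equiv.Perm ι, ∑ r, chi k (x.1 ∘ τ) (x.2 ∘ τ) r • Y r := by
    intro Y
    simp only [hθ, sum_smul, mul_smul, smul_sum]
    rw [sum_comm]
    exact sum_congr rfl fun x _ => sum_comm
  have hθsymm : ∀ (r : ι → α) (κ : Equiv.Perm ι), θ (r ∘ κ) = θ r := by
    intro r κ
    refine sum_congr rfl fun x _ => ?_
    congr 1
    rw [← Equiv.sum_comp (Equiv.mulRight κ)]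
    exact sum_congr rfl fun τ _ => chi_comp_perm κ (x.1 ∘ τ) (x.2 ∘ τ) r
  have hZθ : symOp k θ = N • θ := by
    ext r
    simp only [symOp_apply, hθsymm, sum_const, nsmul_eq_mul, Pi.smul_apply, smul_eq_mul, hN,
      sum_mul]
    exact sum_congr rfl fun I _ => by ring
  -- One factor counts the ways to flip pairs `(p i, q i)`, which changes `c` and `chi` by the same
  -- sign; the other counts the permutations of the pairs, under which `c` is invariant by `hf`.
  set M : k := (Fintype.card (Finset ι) : k) * (Fintype.card (Equiv.Perm ι) : k) with hM
  have hM0 : M ≠ 0 := by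
    rw [hM, ← Nat.cast_mul, Nat.cast_ne_zero]
    exact mul_ne_zero Fintype.card_ne_zero Fintype.card_ne_zero
  have hdiff : M • symOp k f - θ ∈ orthAdmissible ι α k V := by
    intro Y hY
    simp only [Pi.sub_apply, sub_smul, sum_sub_distrib, sub_eq_zero, Pi.smul_apply, smul_eq_mul,
      mul_smul, ← smul_sum]
    rw [← sum_disjointPairs f hY, hθsum]
    have hflip : ∀ (I : Finset ι) (x : (ι → α) × (ι → α)),
        c (I.piecewise x.2 x.1, I.piecewise x.1 x.2) = (-1) ^ I.card * c x := by
      intro I x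
      simp only [hc, chi_piecewise, mul_sum, mul_assoc]
    have e1 : ∑ x ∈ disjointPairs ι α, c x • ∑ r, chi k x.1 x.2 r • Y r =
        (Fintype.card (Finset ι) : k) • ∑ x ∈ disjointPairs ι α, c x • Y x.1 := by
      have : ∀ I : Finset ι, ∑ x ∈ disjointPairs ι α, c x • Y x.1 =
          ∑ x ∈ disjointPairs ι α, c x • (-1 : k) ^ I.card • Y (I.piecewise x.2 x.1) := by
        intro I
        rw [← sum_disjointPairs_piecewise I]
        refine sum_congr rfl fun x _ => ?_
        rw [hflip, mul_comm, mul_smul]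
      simp only [sum_chi_smul, smul_sum]
      rw [sum_comm]
      simp only [← smul_sum]
      rw [sum_congr rfl fun I _ => (this I).symm, sum_const, card_univ, Nat.cast_smul_eq_nsmul]
    have e2 : ∑ x ∈ disjointPairs ι α, c x •
        ∑ τ : Equiv.Perm ι, ∑ r, chi k (x.1 ∘ τ) (x.2 ∘ τ) r • Y r =
        (Fintype.card (Equiv.Perm ι) : k) •
          ∑ x ∈ disjointPairs ι α, c x • ∑ r, chi k x.1 x.2 r • Y r := by
      have : ∀ τ : Equiv.Perm ι, ∑ x ∈ disjointPairs ι α, c x • ∑ r, chi k x.1 x.2 r • Y r =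
          ∑ x ∈ disjointPairs ι α, c x • ∑ r, chi k (x.1 ∘ τ) (x.2 ∘ τ) r • Y r := by
        intro τ
        rw [← sum_disjointPairs_comp_perm τ]
        refine sum_congr rfl fun x hx => ?_
        rw [disjointPairs, mem_filter] at hx
        congr 1
        exact hf x.1 x.2 τ hx.2
      simp only [smul_sum (s := (univ : Finset (Equiv.Perm ι)))]
      rw [sum_comm, sum_congr rfl fun τ _ => (this τ).symm, sum_const, card_univ,
        Nat.cast_smul_eq_nsmul]
    rw [e2, e1, hM, mul_comm, mul_smul]
  have hmem : (N * M) • f - θ ∈ orthAdmissible ι α k V := by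
    apply mem_orthAdmissible_of_symOp h
    have : symOp k ((N * M) • f - θ) = N • (M • symOp k f - θ) := by
      rw [map_sub, map_smul, hZθ, smul_sub, mul_smul]
    rw [this]
    exact Submodule.smul_mem _ _ hdiff
  have hfin := hmem X hX
  simp only [Pi.sub_apply, sub_smul, sum_sub_distrib, sub_eq_zero, Pi.smul_apply, smul_eq_mul,
    mul_smul, ← smul_sum] at hfin
  rw [← mul_smul, hθsum] at hfin
  rw [← Submodule.smul_mem_iff _ (mul_ne_zero hN0 hM0), hfin]
  refine Submodule.sum_mem _ fun x hx => Submodule.smul_mem _ _ (Submodule.subset_span ?_)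
  rw [disjointPairs, mem_filter] at hx
  exact ⟨x.1, x.2, hx.2, rfl⟩

end SlotFunctions

/-! ### Admissible functions built from column determinants. -/

section ColumnFunctions

set_option linter.unusedSectionVars false

variable {ι α : Type*} [Fintype ι] [DecidableEq ι] [Fintype α] [DecidableEq α]
variable (k : Type*) [Field k]

/-- The matrix with a first row of ones, followed by the rows `δ_{a i}` restricted to the
points `b j`. -/
def colMatrix {t : ℕ} (b : Fin (t + 1) → α) (a : Fin t → α) :
    Matrix (Fin (t + 1)) (Fin (t + 1)) k :=
  Matrix.of (Fin.cons (fun _ => 1) fun i j => if a i = b j then 1 else 0)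

/-- The determinant attached to a column with entries `b`. -/
def colDet {t : ℕ} (b : Fin (t + 1) → α) (a : Fin t → α) : k := (colMatrix k b a).det

variable {k}

theorem colDet_eq_zero_of_eq {t : ℕ} (b : Fin (t + 1) → α) (a : Fin t → α) {i j : Fin t}
    (hij : i ≠ j) (h : a i = a j) : colDet k b a = 0 := by
  refine Matrix.det_zero_of_row_eq (i := i.succ) (j := j.succ) (by simpa using hij) ?_
  ext l
  simp [colMatrix, h]

theorem colDet_eq_zero_of_forall_ne {t : ℕ} (b : Fin (t + 1) → α) (a : Fin t → α) {i : Fin t}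
    (h : ∀ j, a i ≠ b j) : colDet k b a = 0 := by
  refine Matrix.det_eq_zero_of_row_eq_zero i.succ fun l => ?_
  simp [colMatrix, h]

/-- The rows `δ_x` restricted to the points `b j` add up, over all `x`, to the row of ones, which
the matrix already has on top. -/
theorem sum_colDet_update {t : ℕ} (b : Fin (t + 1) → α) (a : Fin t → α) (i : Fin t) :
    ∑ x, colDet k b (Function.update a i x) = 0 := by
  set A : Fin (t + 1) → Fin (t + 1) → k := colMatrix k b a with hA
  have h : ∀ x, colDet k b (Function.update a i x) = Matrix.detRowAlternating
      (Function.update A i.succ fun j => if x = b j then 1 else 0) := by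
    intro x
    refine congrArg Matrix.detRowAlternating ?_
    ext l j
    refine Fin.cases ?_ (fun l => ?_) l
    · rw [Function.update_of_ne (Fin.succ_ne_zero i).symm]
      simp [hA, colMatrix]
    · rcases eq_or_ne l i with rfl | hl
      · simp [colMatrix]
      · rw [Function.update_of_ne (by simpa using hl)]
        simp [hA, colMatrix, hl]
  simp only [h]
  have h2 := MultilinearMap.map_update_sum
    (Matrix.detRowAlternating (n := Fin (t + 1)) (R := k)).toMultilinearMap univ i.succ
    (fun (x : α) j => if x = b j then (1 : k) else 0) A
  refine h2.symm.trans ?_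
  refine Matrix.det_zero_of_row_eq (i := 0) (j := i.succ) (Fin.succ_ne_zero i).symm ?_
  ext l
  rw [Function.update_self, Function.update_of_ne (Fin.succ_ne_zero i).symm]
  simp [hA, colMatrix]

/-- The new last row is `(0, …, 0, 1)`; expand along it. -/
theorem colDet_snoc {t : ℕ} (b : Fin (t + 1) → α) (a : Fin t → α) (v : α) (hv : ∀ j, b j ≠ v) :
    colDet k (Fin.snoc b v : Fin (t + 2) → α) (Fin.snoc a v : Fin (t + 1) → α) =
      colDet k b a := by
  rw [colDet, Matrix.det_succ_row _ (Fin.last _), Fin.sum_univ_castSucc, sum_eq_zero, zero_add]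
  · have h1 : colMatrix k (Fin.snoc b v : Fin (t + 2) → α) (Fin.snoc a v : Fin (t + 1) → α)
        (Fin.last _) (Fin.last _) = 1 := by
      rw [← Fin.succ_last]
      simp only [colMatrix, Matrix.of_apply, Fin.cons_succ, Fin.snoc_last]
      rw [if_pos]
      rw [Fin.succ_last, Fin.snoc_last]
    rw [h1, ← two_mul, pow_mul]
    simp only [neg_one_sq, one_pow, one_mul]
    rw [colDet]
    congr 1
    ext i j
    simp only [Matrix.submatrix_apply, Fin.succAbove_last]
    refine Fin.cases ?_ (fun i => ?_) i
    · simp [colMatrix]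
    · simp [colMatrix]
  · intro j _
    have h0 : colMatrix k (Fin.snoc b v : Fin (t + 2) → α) (Fin.snoc a v : Fin (t + 1) → α)
        (Fin.last _) (Fin.castSucc j) = 0 := by
      rw [← Fin.succ_last]
      simp only [colMatrix, Matrix.of_apply, Fin.cons_succ, Fin.snoc_last, Fin.snoc_castSucc]
      rw [if_neg (hv j).symm]
    rw [h0]
    ring

variable (k)

/-- The product of the determinant of the column `b`, in the arguments `e`, and of the functions
`δ_{p i} - δ_{q i}` in the remaining arguments. -/
def colFn {t : ℕ} (e : Fin t → ι) (b : Fin (t + 1) → α) (p q r : ι → α) : k :=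
  colDet k b (r ∘ e) *
    ∏ i ∈ (univ.image e)ᶜ, ((if r i = p i then 1 else 0) - (if r i = q i then 1 else 0))

variable {k}

/-- In the support, arguments in the column take values among the `b l` and every other `r i` is `p
i` or `q i`. These value sets are disjoint, so a coincidence must occur inside the column, where two
rows of the determinant become equal. -/
theorem isAdmissible_colFn {t : ℕ} {e : Fin t → ι} (he : Function.Injective e)
    {b : Fin (t + 1) → α} {p q : ι → α}
    (hb : ∀ i ∉ univ.image e, ∀ l, p i ≠ b l ∧ q i ≠ b l)
    (hpq : ∀ i ∉ univ.image e, ∀ j ∉ univ.image e, i ≠ j →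
      p i ≠ p j ∧ p i ≠ q j ∧ q i ≠ p j ∧ q i ≠ q j) :
    IsAdmissible (colFn k e b p q) := by
  constructor
  · intro r hr
    rw [Function.not_injective_iff] at hr
    obtain ⟨i, j, hij, hne⟩ := hr
    by_contra h0
    obtain ⟨h1, h2⟩ := mul_ne_zero_iff.1 h0
    rw [prod_ne_zero_iff] at h2
    have hval : ∀ i ∉ univ.image e, r i = p i ∨ r i = q i := by
      intro i hi
      by_contra hcon
      rw [not_or] at hcon
      apply h2 i (by simpa using hi)
      rw [if_neg hcon.1, if_neg hcon.2, sub_zero]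
    have hcol : ∀ c, ∃ l, r (e c) = b l := by
      intro c
      by_contra hcon
      rw [not_exists] at hcon
      exact h1 (colDet_eq_zero_of_forall_ne b (r ∘ e) (i := c) hcon)
    have hmix : ∀ c, ∀ j ∉ univ.image e, r (e c) ≠ r j := by
      intro c j hj h
      obtain ⟨l, hl⟩ := hcol c
      rcases hval j hj with h' | h'
      · exact (hb j hj l).1 (by rw [← h', ← h, hl])
      · exact (hb j hj l).2 (by rw [← h', ← h, hl])
    by_cases hi : i ∈ univ.image e <;> by_cases hj : j ∈ univ.image e
    · obtain ⟨c, -, rfl⟩ := mem_image.1 hi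
      obtain ⟨c', -, rfl⟩ := mem_image.1 hj
      exact h1 (colDet_eq_zero_of_eq b (r ∘ e) (i := c) (j := c') (fun h => hne (by rw [h])) hij)
    · obtain ⟨c, -, rfl⟩ := mem_image.1 hi
      exact hmix c j hj hij
    · obtain ⟨c', -, rfl⟩ := mem_image.1 hj
      exact hmix c' i hi hij.symm
    · obtain ⟨g1, g2, g3, g4⟩ := hpq i hi j hj hne
      rcases hval i hi with h | h <;> rcases hval j hj with h' | h'
      · exact g1 (by rw [← h, ← h', hij])
      · exact g2 (by rw [← h, ← h', hij])
      · exact g3 (by rw [← h, ← h', hij])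
      · exact g4 (by rw [← h, ← h', hij])
  · intro i r
    by_cases hi : i ∈ univ.image e
    · obtain ⟨c, -, rfl⟩ := mem_image.1 hi
      have : ∀ a, colFn k e b p q (Function.update r (e c) a) =
          colDet k b (Function.update (r ∘ e) c a) * ∏ i ∈ (univ.image e)ᶜ,
            ((if r i = p i then 1 else 0) - (if r i = q i then 1 else 0)) := by
        intro a
        rw [colFn, Function.update_comp_eq_of_injective r he]
        congr 1
        refine prod_congr rfl fun i hi' => ?_
        rw [Function.update_of_ne]
        rintro rfl
        exact absurd hi (mem_compl.1 hi')
      simp only [this]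
      rw [← sum_mul, sum_colDet_update, zero_mul]
    · have : ∀ a, colFn k e b p q (Function.update r i a) =
          ((if a = p i then 1 else 0) - (if a = q i then 1 else 0)) * (colDet k b (r ∘ e) *
            ∏ i ∈ (univ.image e)ᶜ.erase i,
              ((if r i = p i then 1 else 0) - (if r i = q i then 1 else 0))) := by
        intro a
        rw [colFn, Function.update_comp_eq_of_forall_ne, ← mul_prod_erase _ _ (mem_compl.2 hi),
          Function.update_self, mul_left_comm]
        · congr 2
          refine prod_congr rfl fun j hj => ?_
          rw [Function.update_of_ne (ne_of_mem_erase hj)]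
        · rintro c rfl
          exact hi (mem_image_of_mem _ (mem_univ _))
      simp only [this]
      rw [← sum_mul, sum_sub_distrib]
      simp

/-- Lengthen the column by the two new slots and the two new points `u`, `v`; by `colDet_snoc`,
placing the new slots at `u` and `v` gives back the original determinant. -/
theorem exists_admissible_extension {t : ℕ} {e : Fin t → ι} (he : Function.Injective e)
    {b : Fin (t + 1) → α} {p q : ι → α}
    (hb : ∀ i ∉ univ.image e, ∀ l, p i ≠ b l ∧ q i ≠ b l)
    (hpq : ∀ i ∉ univ.image e, ∀ j ∉ univ.image e, i ≠ j →
      p i ≠ p j ∧ p i ≠ q j ∧ q i ≠ p j ∧ q i ≠ q j) {u v : α} (huv : u ≠ v)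
    (hub : ∀ l, b l ≠ u) (hvb : ∀ l, b l ≠ v)
    (hu : ∀ i ∉ univ.image e, p i ≠ u ∧ q i ≠ u) (hv : ∀ i ∉ univ.image e, p i ≠ v ∧ q i ≠ v) :
    ∃ φ : (ι ⊕ Fin 2 → α) → k, IsAdmissible φ ∧
      ∀ r, φ (Sum.elim r ![u, v]) = colFn k e b p q r := by
  set e' : Fin (t + 2) → ι ⊕ Fin 2 :=
    Fin.snoc (Fin.snoc (Sum.inl ∘ e) (Sum.inr 0) : Fin (t + 1) → ι ⊕ Fin 2) (Sum.inr 1) with he'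
  set b' : Fin (t + 3) → α := Fin.snoc (Fin.snoc b u : Fin (t + 2) → α) v with hb'
  have himg : ∀ x, x ∉ univ.image e' ↔ ∃ i, i ∉ univ.image e ∧ x = Sum.inl i := by
    intro x
    simp only [mem_image, mem_univ, true_and, Fin.exists_fin_succ', he', Fin.snoc_castSucc,
      Fin.snoc_last, Function.comp_apply]
    rcases x with x | x
    · simp
    · fin_cases x <;> simp
  have he'inj : Function.Injective e' := by
    rw [he', Fin.snoc_injective_iff, Fin.snoc_injective_iff]
    refine ⟨⟨Sum.inl_injective.comp he, ?_⟩, ?_⟩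
    · simp
    · rintro ⟨c, hc⟩
      revert hc
      refine Fin.lastCases ?_ (fun c => ?_) c
      · simp
      · simp
  -- The values of `p` and `q` at the new slots are arbitrary, since these slots belong to the
  -- column.
  refine ⟨colFn k e' b' (Sum.elim p fun _ => u) (Sum.elim q fun _ => u), ?_, ?_⟩
  · refine isAdmissible_colFn he'inj ?_ ?_
    · intro x hx l
      obtain ⟨i, hi, rfl⟩ := (himg x).1 hx
      simp only [Sum.elim_inl, hb']
      refine Fin.lastCases ?_ (fun l => ?_) l
      · simpa using hv i hi
      · refine Fin.lastCases ?_ (fun l => ?_) l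
        · simpa using hu i hi
        · simpa using hb i hi l
    · intro x hx y hy hxy
      obtain ⟨i, hi, rfl⟩ := (himg x).1 hx
      obtain ⟨j, hj, rfl⟩ := (himg y).1 hy
      exact hpq i hi j hj fun h => hxy (by rw [h])
  · intro r
    rw [colFn, colFn]
    congr 1
    · have : Sum.elim r ![u, v] ∘ e' =
          Fin.snoc (Fin.snoc (r ∘ e) u : Fin (t + 1) → α) v := by
        ext l
        refine Fin.lastCases ?_ (fun l => ?_) l
        · simp [he']
        · refine Fin.lastCases ?_ (fun l => ?_) l
          · simp [he']
          · simp [he']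
      rw [this, hb', colDet_snoc, colDet_snoc _ _ _ hub]
      intro l
      refine Fin.lastCases ?_ (fun l => ?_) l
      · simpa using huv
      · simpa using hvb l
    · have : (univ.image e')ᶜ = (univ.image e)ᶜ.map Function.Embedding.inl := by
        ext x
        rw [mem_compl, himg, mem_map]
        simp only [mem_compl, Function.Embedding.inl_apply]
        exact ⟨fun ⟨i, h, h'⟩ => ⟨i, h, h'.symm⟩, fun ⟨i, h, h'⟩ => ⟨i, h, h'.symm⟩⟩
      rw [this, prod_map]
      rfl

end ColumnFunctions

/-! ### Coordinates and characteristic polynomials in `A_{m+1}`. -/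

section SquareZeroAlgebra

variable (k : Type*) [Field k] (m : ℕ)

/-- The map from `A_{m+1}` to the trivial square-zero extension of `k` by `k^m`. -/
def aHom : AAlg k m →ₐ[k] TrivSqZeroExt k (Fin m → k) :=
  Ideal.Quotient.liftₐ _
    (MvPolynomial.aeval fun i => (TrivSqZeroExt.inr (Pi.single i 1) : TrivSqZeroExt k (Fin m → k)))
    (by
      intro a ha
      rw [← RingHom.mem_ker]
      have : (Ideal.span (Set.range (MvPolynomial.X : Fin m → MvPolynomial (Fin m) k))) ^ 2 ≤
          RingHom.ker (MvPolynomial.aeval fun i =>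
            (TrivSqZeroExt.inr (Pi.single i 1) : TrivSqZeroExt k (Fin m → k))) := by
        rw [pow_two, Ideal.span_mul_span', Ideal.span_le]
        rintro _ ⟨_, ⟨i, rfl⟩, _, ⟨j, rfl⟩, rfl⟩
        simp [RingHom.mem_ker, TrivSqZeroExt.inr_mul_inr]
      exact this ha)

theorem aHom_aVar (i : Fin m) : aHom k m (aVar k m i) = TrivSqZeroExt.inr (Pi.single i 1) := by
  rw [aHom, aVar]
  erw [Ideal.Quotient.liftₐ_apply, Ideal.Quotient.lift_mk]
  simp

/-- The coordinates of an element of `A_{m+1}` with respect to `1, x_1, …, x_m`. -/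
def aCoord (s : Fin (m + 1)) : AAlg k m →ₗ[k] k :=
  Fin.cases (motive := fun _ => AAlg k m →ₗ[k] k)
    ((TrivSqZeroExt.fstHom k k (Fin m → k)).comp (aHom k m)).toLinearMap
    (fun i => LinearMap.proj i ∘ₗ TrivSqZeroExt.sndHom k (Fin m → k) ∘ₗ (aHom k m).toLinearMap) s

variable {k m}

theorem aCoord_zero_apply (a : AAlg k m) : aCoord k m 0 a = (aHom k m a).fst := rfl

theorem aCoord_succ_apply (i : Fin m) (a : AAlg k m) :
    aCoord k m i.succ a = (aHom k m a).snd i := rfl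

theorem aCoord_zero_one : aCoord k m 0 1 = 1 := by simp [aCoord_zero_apply]

theorem aCoord_succ_one (i : Fin m) : aCoord k m i.succ 1 = 0 := by simp [aCoord_succ_apply]

theorem aCoord_zero_aVar (i : Fin m) : aCoord k m 0 (aVar k m i) = 0 := by
  simp [aCoord_zero_apply, aHom_aVar]

theorem aCoord_succ_aVar (i j : Fin m) :
    aCoord k m j.succ (aVar k m i) = if j = i then 1 else 0 := by
  simp [aCoord_succ_apply, aHom_aVar, Pi.single_apply]

theorem aCoord_zero_aVar_mul (i : Fin m) (a : AAlg k m) : aCoord k m 0 (aVar k m i * a) = 0 := by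
  simp [aCoord_zero_apply, aHom_aVar]

theorem aCoord_succ_aVar_mul (i j : Fin m) (a : AAlg k m) :
    aCoord k m j.succ (aVar k m i * a) = if j = i then aCoord k m 0 a else 0 := by
  simp [aCoord_succ_apply, aCoord_zero_apply, aHom_aVar, Pi.single_apply]

variable (k m)

theorem span_one_aVar : Submodule.span k (Set.range (Fin.cons (1 : AAlg k m) (aVar k m) :
    Fin (m + 1) → AAlg k m)) = ⊤ := by
  rw [Fin.range_cons, eq_top_iff]
  rintro x -
  obtain ⟨p, rfl⟩ := Ideal.Quotient.mk_surjective x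
  induction p using MvPolynomial.induction_on with
  | C a =>
    have h : (Ideal.Quotient.mk _ (MvPolynomial.C a) : AAlg k m) = a • (1 : AAlg k m) := by
      rw [Algebra.smul_def, mul_one]; rfl
    rw [h]
    exact Submodule.smul_mem _ _ (Submodule.subset_span (Set.mem_insert _ _))
  | add p q hp hq => rw [map_add]; exact Submodule.add_mem _ hp hq
  | mul_X p i hp =>
    rw [map_mul]
    change _ * aVar k m i ∈ _
    generalize (Ideal.Quotient.mk _ p : AAlg k m) = y at hp ⊢
    induction hp using Submodule.span_induction with
    | mem x hx =>
      rcases hx with rfl | ⟨j, rfl⟩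
      · rw [one_mul]
        exact Submodule.subset_span (Set.mem_insert_of_mem _ ⟨i, rfl⟩)
      · rw [aVar_mul]; exact Submodule.zero_mem _
    | zero => rw [zero_mul]; exact Submodule.zero_mem _
    | add x y _ _ hx hy => rw [add_mul]; exact Submodule.add_mem _ hx hy
    | smul c x _ hx => rw [smul_mul_assoc]; exact Submodule.smul_mem _ _ hx

theorem exists_eq_smul_one_add_sum (a : AAlg k m) :
    ∃ (c : k) (b : Fin m → k), a = c • 1 + ∑ i, b i • aVar k m i := by
  have : a ∈ Submodule.span k (Set.range (Fin.cons (1 : AAlg k m) (aVar k m) :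
    Fin (m + 1) → AAlg k m)) := by rw [span_one_aVar]; trivial
  obtain ⟨c, hc⟩ := (Submodule.mem_span_range_iff_exists_fun k).1 this
  refine ⟨c 0, fun i => c i.succ, ?_⟩
  rw [← hc, Fin.sum_univ_succ]
  simp

theorem linearIndependent_one_aVar : LinearIndependent k (Fin.cons (1 : AAlg k m) (aVar k m) :
    Fin (m + 1) → AAlg k m) := by
  rw [Fintype.linearIndependent_iff]
  intro g hg i
  have h := congrArg (aCoord k m i) hg
  rw [Fin.sum_univ_succ] at h
  revert h
  refine Fin.cases ?_ (fun i => ?_) i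
  · simp [aCoord_zero_one, aCoord_zero_aVar]
  · simp [aCoord_succ_one, aCoord_succ_aVar]

theorem finrank_aAlg : Module.finrank k (AAlg k m) = m + 1 := by
  rw [Module.finrank_eq_card_basis (Module.Basis.mk (linearIndependent_one_aVar k m)
    (span_one_aVar k m).ge), Fintype.card_fin]

/-- Multiplication by the square-zero part is nilpotent, with characteristic polynomial `X ^ (m +
1)`; adding the scalar `c` translates the variable. -/
theorem charpoly_mulLeft (c : k) (b : Fin m → k) :
    (LinearMap.mulLeft k (c • 1 + ∑ i, b i • aVar k m i : AAlg k m)).charpoly =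
      (Polynomial.X - Polynomial.C c) ^ (m + 1) := by
  set y : AAlg k m := ∑ i, b i • aVar k m i with hy
  have hyy : y * y = 0 := by
    rw [hy, sum_mul_sum]
    exact sum_eq_zero fun i _ => sum_eq_zero fun j _ => by
      rw [smul_mul_smul_comm, aVar_mul, smul_zero]
  have h1 : LinearMap.mulLeft k (c • 1 + y) = LinearMap.mulLeft k y - (-c) • 1 := by
    refine LinearMap.ext fun x => ?_
    simp [add_mul, add_comm]
  have h2 : IsNilpotent (LinearMap.mulLeft k y) := by
    refine ⟨2, ?_⟩
    refine LinearMap.ext fun x => ?_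
    simp [pow_two, ← mul_assoc, hyy]
  rw [h1, LinearMap.charpoly_sub_smul, h2.charpoly_eq_X_pow_finrank, finrank_aAlg]
  simp [sub_eq_add_neg]

end SquareZeroAlgebra

/-! ### Elementary symmetric functions of square-zero elements with sum zero. -/

section EsymmOfSquareZero

/-- All power sums of positive degree vanish, so Newton's identity reads `j * e_j = 0`, and `j` is
invertible. -/
theorem esymm_eq_zero_of_sq_eq_zero {B : Type*} [CommRing B] [Algebra ℚ B] {n : ℕ}
    (β : Fin n → B) (hsq : ∀ i, β i * β i = 0) (hsum : ∑ i, β i = 0) {j : ℕ} (hj : 1 ≤ j) :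
    (Multiset.map β univ.val).esymm j = 0 := by
  rw [← MvPolynomial.aeval_esymm_eq_multiset_esymm (Fin n) ℚ]
  have h := congrArg (MvPolynomial.aeval β) (MvPolynomial.mul_esymm_eq_sum (Fin n) ℚ j)
  have h0 : ∀ r, 1 ≤ r → MvPolynomial.aeval β (MvPolynomial.psum (Fin n) ℚ r) = 0 := by
    intro r hr
    rw [MvPolynomial.psum, map_sum]
    simp only [map_pow, MvPolynomial.aeval_X]
    rcases hr.eq_or_lt with rfl | hr
    · simpa using hsum
    · refine sum_eq_zero fun i _ => ?_
      obtain ⟨s, rfl⟩ := Nat.exists_eq_add_of_le hr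
      rw [pow_add, pow_succ, pow_one, hsq, zero_mul]
  rw [map_mul, map_mul, map_sum, sum_eq_zero, mul_zero] at h
  · rw [map_natCast] at h
    have hu : IsUnit (j : B) := by
      have : IsUnit (algebraMap ℚ B j) := (IsUnit.mk0 (j : ℚ) (by positivity)).map _
      simpa using this
    exact hu.mul_right_eq_zero.1 h
  · rintro ⟨x, y⟩ hxy
    rw [mem_filter, HasAntidiagonal.mem_antidiagonal] at hxy
    rw [map_mul, h0 y (by have := hxy.1; have := hxy.2; simp only at *; omega), mul_zero]

theorem prod_X_sub_C_of_sq_eq_zero {B : Type*} [CommRing B] [Algebra ℚ B] {n : ℕ}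
    (β : Fin n → B) (hsq : ∀ i, β i * β i = 0) (hsum : ∑ i, β i = 0) (c : B) :
    (Multiset.map (fun t => Polynomial.X - Polynomial.C t)
      (Multiset.map (fun i => c + β i) univ.val)).prod = (Polynomial.X - Polynomial.C c) ^ n := by
  have h1 : (Multiset.map (fun t => Polynomial.X - Polynomial.C t)
      (Multiset.map β univ.val)).prod = (Polynomial.X : Polynomial B) ^ n := by
    rw [Multiset.prod_X_sub_X_eq_sum_esymm, sum_range_succ', sum_eq_zero, zero_add]
    · simp [Multiset.esymm]
    · intro j _
      rw [esymm_eq_zero_of_sq_eq_zero β hsq hsum (Nat.le_add_left 1 j)]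
      simp
  have h2 := congrArg (fun P => P.comp (Polynomial.X - Polynomial.C c)) h1
  simp only [Polynomial.pow_comp, Polynomial.X_comp, Multiset.map_map] at h2
  rw [← h2, Multiset.map_map]
  simp only [← Finset.prod_eq_multiset_prod, Polynomial.prod_comp]
  refine prod_congr rfl fun i _ => ?_
  simp [sub_sub]

end EsymmOfSquareZero

/-! ### The linear relations generate the Galois closure ideal. -/

section GaloisIdeal

/-- The ideal of the tensor power generated by the sums `∑ j, x_i^{(j)}`. -/
def sumIdeal (B A : Type*) [CommRing B] [CommRing A] [Algebra B A] (n : ℕ) {ι : Type*}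
    (x : ι → A) : Ideal (⨂[B] _ : Fin n, A) :=
  Ideal.span (Set.range fun i => ∑ j, tensorConj B A n j (x i))

theorem neg_one_pow_mul_cancel {R : Type*} [CommRing R] (j : ℕ) (x : R) :
    (-1) ^ j * ((-1) ^ j * x) = x := by
  rw [← mul_assoc, ← mul_pow]
  simp

/-- Modulo `I` the conjugates are `c + β i` with `β i ^ 2 = 0` and `∑ β i = 0`, so both terms are
the same signed coefficient of `(X - c) ^ n`. -/
theorem charCoeff_sub_esymm_mem {k A : Type*} [Field k] [CharZero k] [CommRing A] [Algebra k A]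
    [Module.Finite k A] {n : ℕ} {I : Ideal (⨂[k] _ : Fin n, A)} {c : k} {y : A}
    (hyy : y * y = 0) (hy : ∑ j, tensorConj k A n j y ∈ I)
    (hchar : (LinearMap.mulLeft k (c • 1 + y)).charpoly = (Polynomial.X - Polynomial.C c) ^ n)
    {j : ℕ} (hj : 1 ≤ j) (hjn : j ≤ n) :
    algebraMap k (⨂[k] _ : Fin n, A) (charCoeff k A n j (c • 1 + y)) -
      MvPolynomial.aeval (fun i => tensorConj k A n i (c • 1 + y))
        (MvPolynomial.esymm (Fin n) k j) ∈ I := by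
  let _ : Algebra ℚ ((⨂[k] _ : Fin n, A) ⧸ I) :=
    ((algebraMap k _).comp (algebraMap ℚ k)).toAlgebra
  set Q := Ideal.Quotient.mkₐ k I with hQ
  set β : Fin n → (⨂[k] _ : Fin n, A) ⧸ I := fun i => Q (tensorConj k A n i y) with hβ
  have hsq : ∀ i, β i * β i = 0 := by
    intro i
    simp only [hβ, tensorConj, ← map_mul, hyy, map_zero]
  have hsum : ∑ i, β i = 0 := by
    simp only [hβ, ← map_sum]
    rwa [hQ, Ideal.Quotient.mkₐ_eq_mk, Ideal.Quotient.eq_zero_iff_mem]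
  rw [← Ideal.Quotient.eq_zero_iff_mem, ← Ideal.Quotient.mkₐ_eq_mk k, ← hQ,
    map_sub, sub_eq_zero, AlgHom.commutes, ← AlgHom.comp_apply, MvPolynomial.comp_aeval,
    MvPolynomial.aeval_esymm_eq_multiset_esymm]
  have hconj : ∀ i, Q (tensorConj k A n i (c • 1 + y)) = algebraMap k _ c + β i := by
    intro i
    simp only [hβ, tensorConj, map_add, map_smul, map_one, Algebra.algebraMap_eq_smul_one]
  simp only [hconj]
  have hP := prod_X_sub_C_of_sq_eq_zero β hsq hsum (algebraMap k _ c)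
  have hcoef := congrArg (fun P => P.coeff (n - j)) hP
  rw [Multiset.prod_X_sub_C_coeff _ (by simp)] at hcoef
  have hcard : (Multiset.map (fun i => algebraMap k ((⨂[k] _ : Fin n, A) ⧸ I) c + β i)
      univ.val).card - (n - j) = j := by
    rw [Multiset.card_map, card_val, card_univ, Fintype.card_fin]
    omega
  rw [hcard] at hcoef
  have hmap : (Polynomial.X - Polynomial.C (algebraMap k ((⨂[k] _ : Fin n, A) ⧸ I) c)) ^ n =
      ((Polynomial.X - Polynomial.C c) ^ n).map (algebraMap k _) := by
    simp
  rw [hmap, Polynomial.coeff_map, ← hchar] at hcoef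
  rw [charCoeff, map_mul, map_pow, map_neg, map_one, ← hcoef]
  exact neg_one_pow_mul_cancel j _

theorem galoisClosureIdeal_le_sumIdeal (k : Type*) [Field k] [CharZero k] (m : ℕ) :
    galoisClosureIdeal k (AAlg k m) (m + 1) ≤ sumIdeal k (AAlg k m) (m + 1) (aVar k m) := by
  rw [galoisClosureIdeal, Ideal.span_le]
  rintro _ ⟨a, j, hj, hjn, rfl⟩
  obtain ⟨c, b, rfl⟩ := exists_eq_smul_one_add_sum k m a
  refine charCoeff_sub_esymm_mem ?_ ?_ (charpoly_mulLeft k m c b) hj hjn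
  · rw [sum_mul_sum]
    exact sum_eq_zero fun i _ => sum_eq_zero fun j _ => by
      rw [smul_mul_smul_comm, aVar_mul, smul_zero]
  · simp only [tensorConj, map_sum, map_smul]
    rw [sum_comm]
    refine Ideal.sum_mem _ fun i _ => ?_
    rw [← smul_sum]
    exact Submodule.smul_of_tower_mem _ _ (Ideal.subset_span ⟨i, rfl⟩)

end GaloisIdeal

/-! ### Functionals on the Galois closure from admissible functions. -/

section TensorFunctional

set_option linter.unusedSectionVars false

variable {k : Type*} [Field k] {m : ℕ} {J : Type*} [Fintype J] [DecidableEq J]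

/-- The functional on the `j`-th tensor factor attached to a placement `R` of the labels `ℓ c`,
`c ∈ K`. -/
def slotCoord (k : Type*) [Field k] {m : ℕ} {J : Type*} (ℓ : J → Fin m) (K : Finset J)
    (R : J → Fin (m + 1)) (j : Fin (m + 1)) : AAlg k m →ₗ[k] k :=
  (∑ c ∈ K, if R c = j then aCoord k m (ℓ c).succ else 0) +
    if ∀ c ∈ K, R c ≠ j then aCoord k m 0 else 0

theorem slotCoord_apply_self (ℓ : J → Fin m) {K : Finset J} {R : J → Fin (m + 1)}
    (hR : Function.Injective R) {c : J} (hc : c ∈ K) :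
    slotCoord k ℓ K R (R c) = aCoord k m (ℓ c).succ := by
  rw [slotCoord, if_neg (by push Not; exact ⟨c, hc, rfl⟩), add_zero, sum_eq_single c]
  · rw [if_pos rfl]
  · intro c' _ hne
    rw [if_neg fun h => hne (hR h)]
  · intro h
    exact absurd hc h

theorem slotCoord_of_forall_ne (ℓ : J → Fin m) {K : Finset J} {R : J → Fin (m + 1)}
    {j : Fin (m + 1)} (h : ∀ c ∈ K, R c ≠ j) : slotCoord k ℓ K R j = aCoord k m 0 := by
  rw [slotCoord, if_pos h, sum_eq_zero, zero_add]
  intro c hc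
  rw [if_neg (h c hc)]

theorem slotCoord_update (ℓ : J → Fin m) {K : Finset J} (R : J → Fin (m + 1)) {c : J}
    (hc : c ∉ K) (x j : Fin (m + 1)) :
    slotCoord k ℓ K (Function.update R c x) j = slotCoord k ℓ K R j := by
  have h : ∀ c' ∈ K, Function.update R c x c' = R c' := fun c' hc' =>
    Function.update_of_ne (ne_of_mem_of_not_mem hc' hc) _ _
  rw [slotCoord, slotCoord]
  congr 1
  · refine sum_congr rfl fun c' hc' => ?_
    rw [h c' hc']
  · have : (∀ c' ∈ K, Function.update R c x c' ≠ j) ↔ ∀ c' ∈ K, R c' ≠ j :=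
      forall₂_congr fun c' hc' => by rw [h c' hc']
    by_cases hh : ∀ c' ∈ K, R c' ≠ j
    · rw [if_pos hh, if_pos (this.2 hh)]
    · rw [if_neg hh, if_neg (mt this.1 hh)]

theorem slotCoord_erase_of_ne (ℓ : J → Fin m) (R : J → Fin (m + 1)) {c : J} {j : Fin (m + 1)}
    (hj : j ≠ R c) : slotCoord k ℓ (univ.erase c) R j = slotCoord k ℓ univ R j := by
  rw [slotCoord, slotCoord]
  congr 1
  · rw [← add_sum_erase _ _ (mem_univ c), if_neg (Ne.symm hj), zero_add]
  · have : (∀ c' ∈ univ.erase c, R c' ≠ j) ↔ ∀ c' ∈ univ, R c' ≠ j := by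
      constructor
      · intro h c' _
        rcases eq_or_ne c' c with rfl | hne
        · exact hj.symm
        · exact h c' (mem_erase.2 ⟨hne, mem_univ _⟩)
      · intro h c' _
        exact h c' (mem_univ _)
    by_cases hh : ∀ c' ∈ univ, R c' ≠ j
    · rw [if_pos hh, if_pos (this.2 hh)]
    · rw [if_neg hh, if_neg (mt this.1 hh)]

/-- The linear functional on the tensor power attached to a function of placements of labels. -/
def tensorFunctional (ℓ : J → Fin m) (φ : (J → Fin (m + 1)) → k) :
    (⨂[k] _ : Fin (m + 1), AAlg k m) →ₗ[k] k :=
  PiTensorProduct.lift (∑ R, φ R •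
    (MultilinearMap.mkPiAlgebra k (Fin (m + 1)) k).compLinearMap (slotCoord k ℓ univ R))

theorem tensorFunctional_tprod (ℓ : J → Fin m) (φ : (J → Fin (m + 1)) → k)
    (a : Fin (m + 1) → AAlg k m) : tensorFunctional ℓ φ (PiTensorProduct.tprod k a) =
      ∑ R, φ R * ∏ j, slotCoord k ℓ univ R j (a j) := by
  rw [tensorFunctional, PiTensorProduct.lift.tprod, _root_.sum_apply]
  refine sum_congr rfl fun R _ => ?_
  rw [_root_.smul_apply, MultilinearMap.compLinearMap_apply,
    MultilinearMap.mkPiAlgebra_apply, smul_eq_mul]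

theorem tensorConj_mul_tprod {B A : Type*} [CommRing B] [CommRing A] [Algebra B A] {n : ℕ}
    (j : Fin n) (x : A) (a : Fin n → A) :
    tensorConj B A n j x * PiTensorProduct.tprod B a =
      PiTensorProduct.tprod B (Function.update a j (x * a j)) := by
  rw [tensorConj, PiTensorProduct.singleAlgHom_apply, PiTensorProduct.tprod_mul_tprod]
  congr 1
  ext l
  rw [Pi.mul_apply, MonoidHom.mulSingle_apply]
  rcases eq_or_ne l j with rfl | hl
  · simp
  · simp [hl]

theorem slotCoord_aVar_mul (ℓ : J → Fin m) {R : J → Fin (m + 1)} (hR : Function.Injective R)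
    (i : Fin m) (j : Fin (m + 1)) (x : AAlg k m) :
    slotCoord k ℓ univ R j (aVar k m i * x) =
      ∑ c, if R c = j ∧ ℓ c = i then aCoord k m 0 x else 0 := by
  by_cases h : ∃ c, R c = j
  · obtain ⟨c, rfl⟩ := h
    rw [slotCoord_apply_self ℓ hR (mem_univ c), aCoord_succ_aVar_mul, sum_eq_single c]
    · simp
    · intro c' _ hne
      rw [if_neg fun h => hne (hR h.1)]
    · simp
  · rw [slotCoord_of_forall_ne ℓ (fun c _ hc => h ⟨c, hc⟩), aCoord_zero_aVar_mul, sum_eq_zero]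
    intro c _
    rw [if_neg fun hc => h ⟨c, hc.1⟩]

/-- A factor `x_i` at position `j` is detected only by a slot `c` with label `i` placed at `j`. Once
`j` is summed out, the cofactor no longer depends on `R c`, so summing `φ` over `R c` gives zero. -/
theorem tensorFunctional_sum_mul (ℓ : J → Fin m) {φ : (J → Fin (m + 1)) → k}
    (hφ : IsAdmissible φ) (i : Fin m) (z : ⨂[k] _ : Fin (m + 1), AAlg k m) :
    tensorFunctional ℓ φ ((∑ j, tensorConj k (AAlg k m) (m + 1) j (aVar k m i)) * z) = 0 := by
  induction z using PiTensorProduct.induction_on with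
  | add x y hx hy => rw [mul_add, map_add, hx, hy, add_zero]
  | smul_tprod r a =>
    rw [mul_smul_comm, map_smul, sum_mul, map_sum]
    simp only [tensorConj_mul_tprod, tensorFunctional_tprod]
    rw [sum_comm]
    have hterm : ∀ R, ∑ j, φ R * ∏ j', slotCoord k ℓ univ R j'
        (Function.update a j (aVar k m i * a j) j') =
        ∑ c, if ℓ c = i then φ R * ∏ j', slotCoord k ℓ (univ.erase c) R j' (a j') else 0 := by
      intro R
      by_cases hR : Function.Injective R
      · have h1 : ∀ j, ∏ j', slotCoord k ℓ univ R j'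
            (Function.update a j (aVar k m i * a j) j') =
            ∑ c, if R c = j ∧ ℓ c = i then
              ∏ j', slotCoord k ℓ (univ.erase c) R j' (a j') else 0 := by
          intro j
          rw [← mul_prod_erase _ _ (mem_univ j), Function.update_self,
            slotCoord_aVar_mul ℓ hR, sum_mul]
          refine sum_congr rfl fun c _ => ?_
          split_ifs with hc
          · obtain ⟨rfl, -⟩ := hc
            rw [← mul_prod_erase _ _ (mem_univ (R c)), slotCoord_of_forall_ne]
            · congr 1
              refine prod_congr rfl fun j' hj' => ?_
              rw [Function.update_of_ne (ne_of_mem_erase hj'),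
                slotCoord_erase_of_ne ℓ R (ne_of_mem_erase hj')]
            · intro c' hc' h
              exact (ne_of_mem_erase hc') (hR h)
          · rw [zero_mul]
        simp only [h1, mul_sum]
        rw [sum_comm]
        refine sum_congr rfl fun c _ => ?_
        rw [sum_eq_single (R c)]
        · simp
        · intro j _ hj
          rw [if_neg fun h => hj h.1.symm, mul_zero]
        · simp
      · simp [hφ.1 R hR]
    simp only [hterm]
    rw [sum_comm, sum_eq_zero, smul_zero]
    intro c _
    split_ifs with hc
    · refine sum_eq_zero_of_sum_update (i := c) fun R => ?_
      simp only [slotCoord_update ℓ R (notMem_erase c univ)]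
      rw [← sum_mul, hφ.2, zero_mul]
    · simp

theorem tensorFunctional_eq_zero [CharZero k] (ℓ : J → Fin m) {φ : (J → Fin (m + 1)) → k}
    (hφ : IsAdmissible φ) {z : ⨂[k] _ : Fin (m + 1), AAlg k m}
    (hz : z ∈ galoisClosureIdeal k (AAlg k m) (m + 1)) : tensorFunctional ℓ φ z = 0 := by
  have h := galoisClosureIdeal_le_sumIdeal k m hz
  clear hz
  rw [sumIdeal] at h
  -- The claim for all multiples makes the induction over the ideal span go through.
  suffices H : ∀ w, tensorFunctional ℓ φ (z * w) = 0 by simpa using H 1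
  induction h using Submodule.span_induction with
  | mem x hx =>
    obtain ⟨i, rfl⟩ := hx
    exact tensorFunctional_sum_mul ℓ hφ i
  | zero =>
    intro w
    rw [zero_mul, map_zero]
  | add x y _ _ hx hy =>
    intro w
    rw [add_mul, map_add, hx, hy, add_zero]
  | smul a x _ hx =>
    intro w
    rw [smul_eq_mul, mul_comm a, mul_assoc, hx]

/-- The pure tensor with `x_{ℓ c}` in position `R c`. -/
def slotTensor (k : Type*) [Field k] {m : ℕ} {J : Type*} [Fintype J] (ℓ : J → Fin m)
    (R : J → Fin (m + 1)) (j : Fin (m + 1)) : AAlg k m :=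
  ∏ c, if R c = j then aVar k m (ℓ c) else 1

theorem slotTensor_apply_self (ℓ : J → Fin m) {R : J → Fin (m + 1)}
    (hR : Function.Injective R) (c : J) : slotTensor k ℓ R (R c) = aVar k m (ℓ c) := by
  rw [slotTensor, prod_eq_single c]
  · rw [if_pos rfl]
  · intro c' _ hne
    rw [if_neg fun h => hne (hR h)]
  · intro h
    exact absurd (mem_univ c) h

theorem slotTensor_of_forall_ne (ℓ : J → Fin m) {R : J → Fin (m + 1)} {j : Fin (m + 1)}
    (h : ∀ c, R c ≠ j) : slotTensor k ℓ R j = 1 :=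
  prod_eq_one fun c _ => if_neg (h c)

theorem prod_tensorConj (ℓ : J → Fin m) (R : J → Fin (m + 1)) (K : Finset J) :
    ∏ c ∈ K, tensorConj k (AAlg k m) (m + 1) (R c) (aVar k m (ℓ c)) =
      PiTensorProduct.tprod k fun j => ∏ c ∈ K, if R c = j then aVar k m (ℓ c) else 1 := by
  induction K using Finset.induction_on with
  | empty => exact PiTensorProduct.one_def
  | insert c K hc ih =>
    rw [prod_insert hc, ih, tensorConj_mul_tprod]
    congr 1
    ext j
    rw [prod_insert hc]
    rcases eq_or_ne j (R c) with rfl | hj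
    · simp
    · rw [Function.update_of_ne hj, if_neg hj.symm, one_mul]

/-- Coordinates and pure tensors are dual, except that two placements give the same monomial when
they differ by a permutation of equally labelled slots. -/
theorem prod_slotCoord_slotTensor [DecidableEq (Fin m)] (ℓ : J → Fin m) {R R' : J → Fin (m + 1)}
    (hR : Function.Injective R) (hR' : Function.Injective R') :
    ∏ j, slotCoord k ℓ univ R j (slotTensor k ℓ R' j) =
      ∑ τ : Equiv.Perm J, if ℓ ∘ τ = ℓ ∧ R = R' ∘ τ then 1 else 0 := by
  by_cases h : ∃ τ : Equiv.Perm J, ℓ ∘ τ = ℓ ∧ R = R' ∘ τ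
  · obtain ⟨τ, hτ, rfl⟩ := h
    rw [sum_eq_single τ, if_pos ⟨hτ, rfl⟩]
    · refine prod_eq_one fun j _ => ?_
      by_cases hj : ∃ c, (R' ∘ τ) c = j
      · obtain ⟨c, rfl⟩ := hj
        rw [slotCoord_apply_self ℓ hR (mem_univ c), Function.comp_apply,
          slotTensor_apply_self ℓ hR', aCoord_succ_aVar, if_pos]
        exact (congrFun hτ c).symm
      · rw [slotCoord_of_forall_ne ℓ (fun c _ hc => hj ⟨c, hc⟩), slotTensor_of_forall_ne,
          aCoord_zero_one]
        intro c hc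
        exact hj ⟨τ.symm c, by simpa using hc⟩
    · rintro τ' _ hne
      rw [if_neg]
      rintro ⟨-, h⟩
      apply hne
      ext c
      exact (hR' (congrFun h c)).symm
    · intro h
      exact absurd (mem_univ τ) h
  · rw [sum_eq_zero fun τ _ => if_neg fun hτ => h ⟨τ, hτ⟩]
    by_contra hne
    rw [← Ne, prod_ne_zero_iff] at hne
    apply h
    have hex : ∀ c, ∃ c', R' c' = R c ∧ ℓ c' = ℓ c := by
      intro c
      have := hne (R c) (mem_univ _)
      rw [slotCoord_apply_self ℓ hR (mem_univ c)] at this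
      by_cases hc : ∃ c', R' c' = R c
      · obtain ⟨c', hc'⟩ := hc
        refine ⟨c', hc', ?_⟩
        rw [← hc', slotTensor_apply_self ℓ hR', aCoord_succ_aVar] at this
        by_contra hl
        rw [if_neg (Ne.symm hl)] at this
        exact this rfl
      · rw [slotTensor_of_forall_ne ℓ (fun c' h => hc ⟨c', h⟩), aCoord_succ_one] at this
        exact absurd rfl this
    choose t ht htl using hex
    have hti : Function.Injective t := fun c c' hc => hR (by rw [← ht, ← ht, hc])
    refine ⟨Equiv.ofBijective t (Finite.injective_iff_bijective.1 hti), ?_, ?_⟩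
    · ext1 c
      exact htl c
    · ext1 c
      exact (ht c).symm

/-- The product `∏ c, x_{ℓ c, R c}` in `G(A_{m+1})`. -/
def slotMonomial (k : Type*) [Field k] {m : ℕ} {J : Type*} [Fintype J] (ℓ : J → Fin m)
    (R : J → Fin (m + 1)) : GA k m :=
  ∏ c, xVar k m (ℓ c) (R c)

theorem slotMonomial_eq_mk (ℓ : J → Fin m) (R : J → Fin (m + 1)) :
    slotMonomial k ℓ R = Ideal.Quotient.mk _
      (∏ c, tensorConj k (AAlg k m) (m + 1) (R c) (aVar k m (ℓ c))) := by
  rw [slotMonomial, map_prod]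
  rfl

theorem prod_tensorConj_of_not_injective (ℓ : J → Fin m) {R : J → Fin (m + 1)}
    (hR : ¬ Function.Injective R) :
    ∏ c, tensorConj k (AAlg k m) (m + 1) (R c) (aVar k m (ℓ c)) = 0 := by
  rw [Function.not_injective_iff] at hR
  obtain ⟨c, c', h, hne⟩ := hR
  rw [← mul_prod_erase _ _ (mem_univ c), ← mul_prod_erase _ _ (mem_erase.2 ⟨hne.symm, mem_univ c'⟩),
    ← mul_assoc, h, tensorConj, tensorConj, ← map_mul, aVar_mul, map_zero, zero_mul]

/-- A linear relation among the monomials is evaluated by the functional of `φ`; each monomial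
contributes the sum of `φ` over the label-preserving permutations of its slots. -/
theorem sum_mul_eq_zero_of_slotMonomial [CharZero k] (ℓ : J → Fin m)
    {φ : (J → Fin (m + 1)) → k} (hφ : IsAdmissible φ) {g : (J → Fin (m + 1)) → k}
    (hg : ∑ R, g R • slotMonomial k ℓ R = 0) :
    ∑ R, g R * ∑ τ : Equiv.Perm J, (if ℓ ∘ τ = ℓ then φ (R ∘ τ) else 0) = 0 := by
  have hz : ∑ R, g R • ∏ c, tensorConj k (AAlg k m) (m + 1) (R c) (aVar k m (ℓ c)) ∈
      galoisClosureIdeal k (AAlg k m) (m + 1) := by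
    rw [← Ideal.Quotient.eq_zero_iff_mem, ← hg, map_sum]
    refine sum_congr rfl fun R _ => ?_
    rw [slotMonomial_eq_mk]
    rfl
  have h := tensorFunctional_eq_zero ℓ hφ hz
  rw [map_sum] at h
  refine Eq.trans (sum_congr rfl fun R' _ => ?_) h
  rw [map_smul, smul_eq_mul]
  congr 1
  by_cases hR' : Function.Injective R'
  · rw [prod_tensorConj, tensorFunctional_tprod]
    have h1 : ∀ R, φ R * ∏ j, slotCoord k ℓ univ R j
        (∏ c, if R' c = j then aVar k m (ℓ c) else 1) =
        ∑ τ : Equiv.Perm J, if ℓ ∘ τ = ℓ ∧ R = R' ∘ τ then φ R else 0 := by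
      intro R
      by_cases hR : Function.Injective R
      · have := prod_slotCoord_slotTensor (k := k) ℓ hR hR'
        simp only [slotTensor] at this
        rw [this, mul_sum]
        refine sum_congr rfl fun τ _ => ?_
        rw [mul_ite, mul_one, mul_zero]
      · simp [hφ.1 R hR]
    simp only [h1]
    rw [sum_comm]
    refine sum_congr rfl fun τ _ => ?_
    by_cases hτ : ℓ ∘ τ = ℓ
    · simp [hτ]
    · simp [hτ]
  · rw [prod_tensorConj_of_not_injective ℓ hR', map_zero]
    refine sum_eq_zero fun τ _ => ?_
    rw [hφ.1 _ fun h => hR' ((Function.Injective.of_comp_iff' R' τ.bijective).1 h), ite_self]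

/-- The defining relation with `j = 1` for `x_i`, whose trace is zero. -/
theorem sum_xVar (i : Fin m) : ∑ j, xVar k m i j = 0 := by
  have h1 : aVar k m i = (0 : k) • 1 + ∑ l, (Pi.single i 1 : Fin m → k) l • aVar k m l := by
    simp [Pi.single_apply]
  have h2 : charCoeff k (AAlg k m) (m + 1) 1 (aVar k m i) = 0 := by
    rw [charCoeff, h1, charpoly_mulLeft]
    simp [Polynomial.coeff_X_pow]
  have h3 : (∑ j, tensorConj k (AAlg k m) (m + 1) j (aVar k m i)) ∈
      galoisClosureIdeal k (AAlg k m) (m + 1) := by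
    rw [← neg_mem_iff]
    refine Ideal.subset_span ⟨aVar k m i, 1, le_rfl, Nat.le_add_left 1 m, ?_⟩
    rw [h2, map_zero, zero_sub, MvPolynomial.esymm_one, map_sum]
    simp only [MvPolynomial.aeval_X]
  rw [← Ideal.Quotient.eq_zero_iff_mem, map_sum] at h3
  exact h3

theorem isAdmissible_slotMonomial (ℓ : J → Fin m) : IsAdmissible (slotMonomial k ℓ) := by
  constructor
  · intro R hR
    rw [slotMonomial_eq_mk, prod_tensorConj_of_not_injective ℓ hR, map_zero]
  · intro c R
    have : ∀ a, slotMonomial k ℓ (Function.update R c a) =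
        xVar k m (ℓ c) a * ∏ c' ∈ univ.erase c, xVar k m (ℓ c') (R c') := by
      intro a
      rw [slotMonomial, ← mul_prod_erase _ _ (mem_univ c), Function.update_self]
      congr 1
      refine prod_congr rfl fun c' hc' => ?_
      rw [Function.update_of_ne (ne_of_mem_erase hc')]
    simp only [this]
    rw [← sum_mul, sum_xVar, zero_mul]

end TensorFunctional

/-! ### Elements of a graded piece killed by `𝔪²`, in terms of coefficients. -/

section GradedPieces

set_option linter.unusedSectionVars false

variable {k : Type*} [Field k] {m : ℕ} {ι : Type*} [Fintype ι] [DecidableEq ι]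

/-- The slots with label `i` are matched with the factors `x_{i,j}` counted with multiplicity; the
position of the matched factor is the value of `R`. -/
theorem exists_slotMonomial_eq (ℓ : ι → Fin m) (e : Fin m × Fin (m + 1) → ℕ)
    (he : ∀ i, ∑ j, e (i, j) = (univ.filter fun c => ℓ c = i).card) :
    ∃ R, slotMonomial k ℓ R = ∏ p, xVar k m p.1 p.2 ^ e p := by
  have hcard : ∀ i, Fintype.card {c // ℓ c = i} = Fintype.card (Σ j, Fin (e (i, j))) := by
    intro i
    rw [Fintype.card_sigma, Fintype.card_subtype, ← he i]
    simp
  have E : ∀ i, {c // ℓ c = i} ≃ Σ j, Fin (e (i, j)) := fun i =>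
    Fintype.equivOfCardEq (hcard i)
  refine ⟨fun c => (E (ℓ c) ⟨c, rfl⟩).1, ?_⟩
  rw [slotMonomial, ← Equiv.prod_comp (Equiv.sigmaFiberEquiv ℓ), Fintype.prod_sigma,
    Fintype.prod_prod_type]
  refine prod_congr rfl fun i _ => ?_
  have h1 : ∀ c : {c // ℓ c = i}, xVar k m (ℓ c) ((E (ℓ c) ⟨c, rfl⟩).1) =
      xVar k m i (E i c).1 := by
    rintro ⟨c, rfl⟩
    rfl
  have h2 : ∏ c : {c // ℓ c = i}, xVar k m i (E i c).1 = ∏ j, xVar k m i j ^ e (i, j) := by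
    rw [Equiv.prod_comp (E i) fun x => xVar k m i x.1, Fintype.prod_sigma]
    simp
  rw [← h2]
  exact prod_congr rfl fun c _ => h1 c

theorem exists_eq_sum_slotMonomial {d : Fin m → ℕ} (ℓ : ι → Fin m)
    (hℓ : ∀ i, (univ.filter fun c => ℓ c = i).card = d i) {f : GA k m}
    (hf : f ∈ gradedPiece k m d) : ∃ g : (ι → Fin (m + 1)) → k, f = ∑ R, g R • slotMonomial k ℓ R := by
  suffices h : f ∈ Submodule.span k (Set.range (slotMonomial k ℓ)) by
    obtain ⟨g, hg⟩ := (Submodule.mem_span_range_iff_exists_fun k).1 h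
    exact ⟨g, hg.symm⟩
  obtain ⟨P, hP, rfl⟩ := hf
  have hP : P.IsWeightedHomogeneous (multiWeight m) d := hP
  rw [AlgHom.toLinearMap_apply, P.as_sum, map_sum]
  refine Submodule.sum_mem _ fun e he => ?_
  have hw := hP (MvPolynomial.mem_support_iff.1 he)
  have he' : ∀ i, ∑ j, e (i, j) = (univ.filter fun c => ℓ c = i).card := by
    intro i
    rw [hℓ, ← hw, Finsupp.weight_apply, Finsupp.sum_fintype _ _ (by simp),
      Fintype.sum_prod_type, Finset.sum_apply, sum_eq_single i]
    · simp [multiWeight]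
    · intro i' _ hne
      simp [multiWeight, hne.symm]
    · simp
  obtain ⟨R, hR⟩ := exists_slotMonomial_eq (k := k) ℓ (fun p => e p) he'
  have : presentation k m (MvPolynomial.monomial e (P.coeff e)) =
      P.coeff e • slotMonomial k ℓ R := by
    rw [hR, presentation, MvPolynomial.aeval_monomial, Finsupp.prod_fintype _ _ (by simp)]
    exact (Algebra.smul_def _ _).symm
  rw [this]
  exact Submodule.smul_mem _ _ (Submodule.subset_span ⟨R, rfl⟩)

theorem mul_xVar_mul_xVar_eq_zero {f : GA k m} (hf : f ∈ annMaxSq k m) (y z : Fin m)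
    (u v : Fin (m + 1)) : f * (xVar k m y u * xVar k m z v) = 0 := by
  have h := (Submodule.mem_annihilator.1 (hf : f ∈ Submodule.annihilator (maxIdeal k m ^ 2)))
    (xVar k m y u * xVar k m z v) ?_
  · exact h
  · rw [pow_two (maxIdeal k m)]
    exact Ideal.mul_mem_mul (Ideal.subset_span ⟨(y, u), rfl⟩) (Ideal.subset_span ⟨(z, v), rfl⟩)

theorem slotMonomial_sumElim (ℓ : ι → Fin m) (R : ι → Fin (m + 1)) (y z : Fin m)
    (u v : Fin (m + 1)) : slotMonomial k (Sum.elim ℓ ![y, z]) (Sum.elim R ![u, v]) =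
      slotMonomial k ℓ R * (xVar k m y u * xVar k m z v) := by
  simp [slotMonomial, Fintype.prod_sum_type]

/-- As `y` and `z` are distinct and not used by `ℓ`, a label-preserving permutation must fix both
extra slots. -/
theorem sum_perm_sum_two {M : Type*} [AddCommMonoid M] (ℓ : ι → Fin m) {y z : Fin m}
    (hyz : y ≠ z) (hy : ∀ c, ℓ c ≠ y) (hz : ∀ c, ℓ c ≠ z) (R : ι → Fin (m + 1))
    (u v : Fin (m + 1)) (φ : (ι ⊕ Fin 2 → Fin (m + 1)) → M) :
    ∑ τ : Equiv.Perm (ι ⊕ Fin 2), (if Sum.elim ℓ ![y, z] ∘ τ = Sum.elim ℓ ![y, z] then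
      φ (Sum.elim R ![u, v] ∘ τ) else 0) =
    ∑ τ : Equiv.Perm ι, if ℓ ∘ τ = ℓ then φ (Sum.elim (R ∘ τ) ![u, v]) else 0 := by
  rw [← sum_filter, ← sum_filter]
  symm
  refine sum_bij (fun τ _ => Equiv.Perm.sumCongr τ 1) ?_ ?_ ?_ ?_
  · intro τ hτ
    simp only [mem_filter, mem_univ, true_and] at hτ ⊢
    ext1 x
    rcases x with c | x
    · exact congrFun hτ c
    · rfl
  · intro τ _ τ' _ h
    ext c
    have := Equiv.congr_fun h (Sum.inl c)
    simpa using this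
  · intro τ hτ
    simp only [mem_filter, mem_univ, true_and] at hτ
    have hinr : ∀ x, τ (Sum.inr x) = Sum.inr x := by
      intro x
      have h1 := congrFun hτ (Sum.inr x)
      rw [Function.comp_apply] at h1
      rcases h2 : τ (Sum.inr x) with c | x'
      · rw [h2] at h1
        fin_cases x
        · exact absurd h1 (hy c)
        · exact absurd h1 (hz c)
      · rw [h2] at h1
        fin_cases x <;> fin_cases x'
        · rfl
        · exact absurd h1.symm hyz
        · exact absurd h1 hyz
        · rfl
    have hinl : ∀ c, ∃ c', τ (Sum.inl c) = Sum.inl c' := by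
      intro c
      rcases h2 : τ (Sum.inl c) with c' | x
      · exact ⟨c', rfl⟩
      · rw [← hinr x] at h2
        have := τ.injective h2
        simp at this
    choose t ht using hinl
    have hti : Function.Injective t := by
      intro c c' h
      have : τ (Sum.inl c) = τ (Sum.inl c') := by rw [ht, ht, h]
      simpa using τ.injective this
    refine ⟨Equiv.ofBijective t (Finite.injective_iff_bijective.1 hti), ?_, ?_⟩
    · simp only [mem_filter, mem_univ, true_and]
      ext1 c
      have := congrFun hτ (Sum.inl c)
      rw [Function.comp_apply, ht] at this
      exact this
    · ext1 x
      rcases x with c | x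
      · simp [ht]
      · simp [hinr]
  · intro τ _
    congr 1
    ext1 x
    rcases x with c | x <;> rfl

theorem sum_ite_smul_sumElim {V : Type*} [AddCommGroup V] [Module k V] {α : Type*} [Fintype α]
    [DecidableEq α] (g : (ι → α) → k) (w : Fin 2 → α) (F : (ι ⊕ Fin 2 → α) → V) :
    ∑ R : ι ⊕ Fin 2 → α, (if R ∘ Sum.inr = w then g (R ∘ Sum.inl) else 0) • F R =
      ∑ R, g R • F (Sum.elim R w) := by
  rw [← Equiv.sum_comp (Equiv.sumArrowEquivProdArrow ι (Fin 2) α).symm, Fintype.sum_prod_type]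
  refine sum_congr rfl fun R _ => ?_
  rw [sum_eq_single w]
  · exact congrArg (· • _) (if_pos rfl)
  · intro w' _ hw
    exact (congrArg (· • _) (if_neg hw)).trans (zero_smul _ _)
  · intro h
    exact absurd (mem_univ _) h

theorem sum_mul_eq_zero_of_mem_annMaxSq [CharZero k] (ℓ : ι → Fin m) {y z : Fin m}
    (hyz : y ≠ z) (hy : ∀ c, ℓ c ≠ y) (hz : ∀ c, ℓ c ≠ z) {g : (ι → Fin (m + 1)) → k}
    (hg : ∑ R, g R • slotMonomial k ℓ R ∈ annMaxSq k m) {φ : (ι ⊕ Fin 2 → Fin (m + 1)) → k}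
    (hφ : IsAdmissible φ) (u v : Fin (m + 1)) :
    ∑ R, g R * ∑ τ : Equiv.Perm ι, (if ℓ ∘ τ = ℓ then φ (Sum.elim (R ∘ τ) ![u, v]) else 0) =
      0 := by
  have h0 : ∑ R : ι ⊕ Fin 2 → Fin (m + 1),
      (if R ∘ Sum.inr = ![u, v] then g (R ∘ Sum.inl) else 0 : k) •
        slotMonomial k (Sum.elim ℓ ![y, z]) R = 0 := by
    refine (sum_ite_smul_sumElim g ![u, v] (slotMonomial k (Sum.elim ℓ ![y, z]))).trans ?_
    have h1 : ∀ R, g R • slotMonomial k (Sum.elim ℓ ![y, z]) (Sum.elim R ![u, v]) =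
        (g R • slotMonomial k ℓ R) * (xVar k m y u * xVar k m z v) := by
      intro R
      rw [slotMonomial_sumElim]
      exact (smul_mul_assoc _ _ _).symm
    rw [sum_congr rfl fun R _ => h1 R, ← sum_mul]
    exact mul_xVar_mul_xVar_eq_zero hg y z u v
  have h1 := sum_mul_eq_zero_of_slotMonomial _ hφ h0
  refine Eq.trans ?_ h1
  have h2 := sum_ite_smul_sumElim g ![u, v] fun R : ι ⊕ Fin 2 → Fin (m + 1) =>
    ∑ τ : Equiv.Perm (ι ⊕ Fin 2), if Sum.elim ℓ ![y, z] ∘ τ = Sum.elim ℓ ![y, z] then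
      φ (R ∘ τ) else 0
  refine Eq.trans ?_ h2.symm
  refine sum_congr rfl fun R _ => ?_
  rw [smul_eq_mul, sum_perm_sum_two ℓ hyz hy hz]

theorem sum_sum_comp_perm_smul {V : Type*} [AddCommGroup V] [Module k V] {α : Type*} [Fintype α]
    [DecidableEq α] {S : Finset (Equiv.Perm ι)} {X : (ι → α) → V}
    (hX : ∀ τ ∈ S, ∀ r, X (r ∘ τ) = X r) (g : (ι → α) → k) :
    ∑ r, (∑ τ ∈ S, g (r ∘ τ)) • X r = (S.card : k) • ∑ r, g r • X r := by
  simp only [sum_smul]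
  rw [sum_comm, Nat.cast_smul_eq_nsmul, ← sum_const]
  refine sum_congr rfl fun τ hτ => ?_
  rw [← sum_comp_perm τ fun r => g r • X r]
  exact sum_congr rfl fun r _ => by rw [hX τ hτ]

/-- Averaging over the label-preserving permutations is moved from `φ` to the coefficients; the
monomials are invariant under them, so `f` is only multiplied by the group order `N`. -/
theorem exists_symmetrized_coefficients [CharZero k] {d : Fin m → ℕ} (ℓ : ι → Fin m)
    (hℓ : ∀ i, (univ.filter fun c => ℓ c = i).card = d i) {y z : Fin m}
    (hyz : y ≠ z) (hy : ∀ c, ℓ c ≠ y) (hz : ∀ c, ℓ c ≠ z) {f : GA k m}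
    (hf : f ∈ gradedPiece k m d ⊓ annMaxSq k m) :
    ∃ (h : (ι → Fin (m + 1)) → k) (N : k), N ≠ 0 ∧ ∑ r, h r • slotMonomial k ℓ r = N • f ∧
      ∀ φ : (ι ⊕ Fin 2 → Fin (m + 1)) → k, IsAdmissible φ → ∀ u v,
        ∑ r, φ (Sum.elim r ![u, v]) * h r = 0 := by
  obtain ⟨g, rfl⟩ := exists_eq_sum_slotMonomial ℓ hℓ hf.1
  set S : Finset (Equiv.Perm ι) := univ.filter fun τ => ℓ ∘ τ = ℓ with hS
  have hstab : ∀ τ ∈ S, ∀ r, slotMonomial k ℓ (r ∘ τ) = slotMonomial k ℓ r := by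
    intro τ hτ r
    rw [hS, mem_filter] at hτ
    rw [slotMonomial, slotMonomial, ← Equiv.prod_comp τ fun c => xVar k m (ℓ c) (r c)]
    refine prod_congr rfl fun c _ => ?_
    rw [Function.comp_apply]
    rw [← Function.comp_apply (f := ℓ), hτ.2]
  have hinv : ∀ τ ∈ S, τ⁻¹ ∈ S := by
    intro τ hτ
    rw [hS, mem_filter] at hτ ⊢
    refine ⟨mem_univ _, ?_⟩
    conv_lhs => rw [← hτ.2]
    ext c
    simp
  refine ⟨fun r => ∑ τ ∈ S, g (r ∘ τ), (S.card : k), ?_, ?_, ?_⟩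
  · rw [Nat.cast_ne_zero]
    exact (card_pos.2 ⟨1, by simp [hS]⟩).ne'
  · exact sum_sum_comp_perm_smul hstab g
  · intro φ hφ u v
    have h1 := sum_mul_eq_zero_of_mem_annMaxSq ℓ hyz hy hz hf.2 hφ u v
    simp only [← sum_filter, mul_sum] at h1
    rw [sum_comm] at h1
    simp only [mul_sum]
    rw [sum_comm, ← h1]
    refine sum_bij' (fun τ _ => τ⁻¹) (fun τ _ => τ⁻¹) hinv hinv (fun τ _ => inv_inv τ)
      (fun τ _ => inv_inv τ) ?_
    intro τ _
    rw [← sum_comp_perm τ fun r => g r * φ (Sum.elim (r ∘ (τ⁻¹ : Equiv.Perm ι)) ![u, v])]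
    refine sum_congr rfl fun r _ => ?_
    rw [mul_comm]
    congr 3
    ext c
    simp

end GradedPieces

/-! ### What orthogonality on two more slots says about pairings with `chi`. -/

section ChiOrthogonality

set_option linter.unusedSectionVars false

variable {k : Type*} [Field k] {ι α : Type*} [Fintype ι] [DecidableEq ι] [Fintype α]
  [DecidableEq α]

theorem chi_eq_prod_mul_prod_compl {t : ℕ} {e : Fin t → ι} (he : Function.Injective e)
    (p q r : ι → α) : chi k p q r =
      (∏ c, ((if r (e c) = p (e c) then 1 else 0) - (if r (e c) = q (e c) then 1 else 0))) *
      ∏ i ∈ (univ.image e)ᶜ, ((if r i = p i then 1 else 0) - (if r i = q i then 1 else 0)) := by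
  rw [chi, ← prod_mul_prod_compl (univ.image e), prod_image fun _ _ _ _ h => he h]

theorem colDet_one (b : Fin 2 → α) (a : Fin 1 → α) :
    colDet k b a = (if a 0 = b 1 then 1 else 0) - (if a 0 = b 0 then 1 else 0) := by
  have h0 : ∀ j, colMatrix k b a 0 j = 1 := fun _ => rfl
  have h1 : ∀ j, colMatrix k b a 1 j = if a 0 = b j then 1 else 0 := fun _ => rfl
  rw [colDet, Matrix.det_fin_two, h0, h0, h1, h1, one_mul, one_mul]

theorem colDet_two (b : Fin 3 → α) (a : Fin 2 → α) :
    colDet k b a =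
      ((if a 0 = b 1 then 1 else 0) * (if a 1 = b 2 then 1 else 0) -
        (if a 0 = b 2 then 1 else 0) * (if a 1 = b 1 then 1 else 0)) -
      ((if a 0 = b 0 then 1 else 0) * (if a 1 = b 2 then 1 else 0) -
        (if a 0 = b 2 then 1 else 0) * (if a 1 = b 0 then 1 else 0)) +
      ((if a 0 = b 0 then 1 else 0) * (if a 1 = b 1 then 1 else 0) -
        (if a 0 = b 1 then 1 else 0) * (if a 1 = b 0 then 1 else 0)) := by
  have h0 : ∀ j, colMatrix k b a 0 j = 1 := fun _ => rfl
  have h1 : ∀ j, colMatrix k b a 1 j = if a 0 = b j then 1 else 0 := fun _ => rfl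
  have h2 : ∀ j, colMatrix k b a 2 j = if a 1 = b j then 1 else 0 := fun _ => rfl
  rw [colDet, Matrix.det_fin_three]
  simp only [h0, h1, h2]
  ring

theorem chi_eq_colFn_zero (e : Fin 0 → ι) (b : Fin 1 → α) (p q r : ι → α) :
    colFn k e b p q r = chi k p q r := by
  rw [chi_eq_prod_mul_prod_compl (e := e) (fun x => x.elim0), colFn, colDet]
  simp [colMatrix]

theorem colFn_one (i : ι) (p q r : ι → α) :
    colFn k ![i] ![p i, q i] p q r = -chi k p q r := by
  rw [chi_eq_prod_mul_prod_compl (e := ![i]) (Function.injective_of_subsingleton _), colFn,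
    ← neg_mul]
  congr 1
  rw [colDet_one, Fin.prod_univ_one, neg_sub]
  rfl

/-- The difference of the two products is antisymmetric in the arguments `r i`, `r j`. It is a sum
of two `3 × 3` determinants, each omitting one of the four points `p i`, `p j`, `q i`, `q j`. -/
theorem colFn_two {i j : ι} (hij : i ≠ j) (p q r : ι → α) :
    colFn k ![i, j] ![p i, p j, q i] p q r + colFn k ![i, j] ![p i, q i, q j] p q r =
      chi k p q r - chi k (p ∘ Equiv.swap i j) (q ∘ Equiv.swap i j) r := by
  have he : Function.Injective ![i, j] := by
    intro a b h
    fin_cases a <;> fin_cases b <;> simp_all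
  have hout : ∏ l ∈ (univ.image ![i, j])ᶜ, ((if r l = (p ∘ Equiv.swap i j) l then (1 : k) else 0) -
      (if r l = (q ∘ Equiv.swap i j) l then 1 else 0)) =
      ∏ l ∈ (univ.image ![i, j])ᶜ, ((if r l = p l then 1 else 0) -
        (if r l = q l then 1 else 0)) := by
    refine prod_congr rfl fun l hl => ?_
    have hl' : l ≠ i ∧ l ≠ j := by
      simp only [mem_compl, mem_image, mem_univ, true_and, not_exists] at hl
      exact ⟨fun h => hl 0 h.symm, fun h => hl 1 h.symm⟩
    simp only [Function.comp_apply, Equiv.swap_apply_of_ne_of_ne hl'.1 hl'.2]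
  rw [chi_eq_prod_mul_prod_compl he, chi_eq_prod_mul_prod_compl he, hout, colFn, colFn, ← add_mul,
    ← sub_mul]
  congr 1
  rw [colDet_two, colDet_two, Fin.prod_univ_two, Fin.prod_univ_two]
  have key : ∀ δ : α → α → k,
      ((δ (r i) (p j) * δ (r j) (q i) - δ (r i) (q i) * δ (r j) (p j)) -
        (δ (r i) (p i) * δ (r j) (q i) - δ (r i) (q i) * δ (r j) (p i)) +
        (δ (r i) (p i) * δ (r j) (p j) - δ (r i) (p j) * δ (r j) (p i))) +
      ((δ (r i) (q i) * δ (r j) (q j) - δ (r i) (q j) * δ (r j) (q i)) -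
        (δ (r i) (p i) * δ (r j) (q j) - δ (r i) (q j) * δ (r j) (p i)) +
        (δ (r i) (p i) * δ (r j) (q i) - δ (r i) (q i) * δ (r j) (p i))) =
      (δ (r i) (p i) - δ (r i) (q i)) * (δ (r j) (p j) - δ (r j) (q j)) -
      (δ (r i) (p j) - δ (r i) (q j)) * (δ (r j) (p i) - δ (r j) (q i)) := fun δ => by ring
  have hi : ∀ f : ι → α, (f ∘ Equiv.swap i j) i = f j := fun f => by simp
  have hj : ∀ f : ι → α, (f ∘ Equiv.swap i j) j = f i := fun f => by simp
  have h0 : (![i, j] : Fin 2 → ι) 0 = i := rfl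
  have h1 : (![i, j] : Fin 2 → ι) 1 = j := rfl
  rw [h0, h1, hi, hi, hj, hj]
  exact key fun x y => if x = y then 1 else 0

variable {h : (ι → α) → k}
  (hh : ∀ φ : (ι ⊕ Fin 2 → α) → k, IsAdmissible φ → ∀ u v,
    ∑ r, φ (Sum.elim r ![u, v]) * h r = 0)
include hh

theorem sum_colFn_mul_eq_zero {t : ℕ} {e : Fin t → ι} (he : Function.Injective e)
    {b : Fin (t + 1) → α} {p q : ι → α} (hinj : Function.Injective (Sum.elim p q))
    (hb : ∀ l, ∀ i ∉ univ.image e, p i ≠ b l ∧ q i ≠ b l) {u v : α} (huv : u ≠ v)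
    (hub : ∀ l, b l ≠ u) (hvb : ∀ l, b l ≠ v)
    (hu : ∀ i ∉ univ.image e, p i ≠ u ∧ q i ≠ u) (hv : ∀ i ∉ univ.image e, p i ≠ v ∧ q i ≠ v) :
    ∑ r, colFn k e b p q r * h r = 0 := by
  have hp : Function.Injective p := hinj.comp Sum.inl_injective
  have hq : Function.Injective q := hinj.comp Sum.inr_injective
  have hpq : ∀ i j, p i ≠ q j := fun i j hij => by
    have := @hinj (Sum.inl i) (Sum.inr j) hij
    simp at this
  obtain ⟨φ, hφ, hφr⟩ := exists_admissible_extension (k := k) he (fun i hi l => hb l i hi)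
    (fun i _ j _ hij => ⟨hp.ne hij, hpq i j, (hpq j i).symm, hq.ne hij⟩) huv hub hvb hu hv
  rw [← hh φ hφ u v]
  exact sum_congr rfl fun r _ => by rw [hφr]

/-- Up to sign, `chi` is a `colFn` whose column is the pair `p i`, `q i`; the two points outside the
ranges of `p` and `q` serve as `u` and `v`. -/
theorem sum_chi_mul_eq_zero (h3 : 3 ≤ Fintype.card α)
    (hcard : 2 * Fintype.card ι + 2 ≤ Fintype.card α) {p q : ι → α}
    (hinj : Function.Injective (Sum.elim p q)) : ∑ r, chi k p q r * h r = 0 := by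
  have hpq : ∀ i j, p i ≠ q j := fun i j hij => by
    have := @hinj (Sum.inl i) (Sum.inr j) hij
    simp at this
  rcases isEmpty_or_nonempty ι with hι | ⟨⟨i⟩⟩
  -- Without slots `chi` is the constant `1`, and the column is a single point; three distinct
  -- points are then needed.
  · obtain ⟨a, b, c, -, -, -, hab, hac, hbc⟩ :=
      Finset.two_lt_card_iff.1 (show 2 < (univ : Finset α).card by rwa [card_univ])
    have := sum_colFn_mul_eq_zero hh (e := Fin.elim0) (b := ![c]) (p := p) (q := q)
      (fun x => x.elim0) hinj (fun _ i => hι.elim i) hab (by simpa using hac.symm)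
      (by simpa using hbc.symm) (fun i => hι.elim i) (fun i => hι.elim i)
    simpa only [chi_eq_colFn_zero] using this
  · have h1 : 1 < ((univ.image (Sum.elim p q))ᶜ).card := by
      rw [card_compl, card_image_of_injective _ hinj, card_univ, Fintype.card_sum]
      omega
    obtain ⟨u, hu, v, hv, huv⟩ := Finset.one_lt_card.1 h1
    simp only [mem_compl, mem_image, mem_univ, true_and, Sum.exists, Sum.elim_inl, Sum.elim_inr,
      not_or, not_exists] at hu hv
    have := sum_colFn_mul_eq_zero hh (e := ![i]) (b := ![p i, q i]) (p := p) (q := q)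
      (Function.injective_of_subsingleton _) hinj ?_ huv ?_ ?_
      (fun j _ => ⟨hu.1 j, hu.2 j⟩) (fun j _ => ⟨hv.1 j, hv.2 j⟩)
    · simpa only [colFn_one, neg_mul, sum_neg_distrib, neg_eq_zero] using this
    · intro l j hj
      have hji : j ≠ i := fun hji => hj (mem_image.2 ⟨0, mem_univ _, hji.symm⟩)
      have hp : p j ≠ p i := fun hp => hji (hinj.comp Sum.inl_injective hp)
      have hq : q j ≠ q i := fun hq => hji (hinj.comp Sum.inr_injective hq)
      fin_cases l
      · exact ⟨hp, (hpq i j).symm⟩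
      · exact ⟨hpq j i, hq⟩
    · intro l
      fin_cases l
      · exact hu.1 i
      · exact hu.2 i
    · intro l
      fin_cases l
      · exact hv.1 i
      · exact hv.2 i

/-- Only one point outside the ranges is guaranteed. Each determinant of `colFn_two` leaves out `q
j` or `p j`, which supplies the second extra point. -/
theorem sum_chi_swap (hcard : 2 * Fintype.card ι + 1 ≤ Fintype.card α) {p q : ι → α}
    (hinj : Function.Injective (Sum.elim p q)) {i j : ι} (hij : i ≠ j) :
    ∑ r, chi k (p ∘ Equiv.swap i j) (q ∘ Equiv.swap i j) r * h r = ∑ r, chi k p q r * h r := by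
  have hpq : ∀ i j, p i ≠ q j := fun i j hij => by
    have := @hinj (Sum.inl i) (Sum.inr j) hij
    simp at this
  have hp : Function.Injective p := hinj.comp Sum.inl_injective
  have hq : Function.Injective q := hinj.comp Sum.inr_injective
  have he : Function.Injective ![i, j] := by
    intro a b h
    fin_cases a <;> fin_cases b <;> simp_all
  have hne : ∀ l ∉ univ.image ![i, j], l ≠ i ∧ l ≠ j := by
    intro l hl
    simp only [mem_image, mem_univ, true_and, not_exists] at hl
    exact ⟨fun h => hl 0 h.symm, fun h => hl 1 h.symm⟩
  have h1 : 0 < ((univ.image (Sum.elim p q))ᶜ).card := by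
    rw [card_compl, card_image_of_injective _ hinj, card_univ, Fintype.card_sum]
    omega
  obtain ⟨u, hu⟩ := card_pos.1 h1
  simp only [mem_compl, mem_image, mem_univ, true_and, Sum.exists, Sum.elim_inl, Sum.elim_inr,
    not_or, not_exists] at hu
  have e1 := sum_colFn_mul_eq_zero hh (e := ![i, j]) (b := ![p i, p j, q i]) (p := p) (q := q)
    (u := q j) (v := u) he hinj ?_ (hu.2 j) ?_ ?_
    (fun l hl => ⟨hpq l j, hq.ne (hne l hl).2⟩) (fun l _ => ⟨hu.1 l, hu.2 l⟩)
  have e2 := sum_colFn_mul_eq_zero hh (e := ![i, j]) (b := ![p i, q i, q j]) (p := p) (q := q)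
    (u := p j) (v := u) he hinj ?_ (hu.1 j) ?_ ?_
    (fun l hl => ⟨hp.ne (hne l hl).2, (hpq j l).symm⟩) (fun l _ => ⟨hu.1 l, hu.2 l⟩)
  · have := congrArg₂ (· + ·) e1 e2
    simp only [← sum_add_distrib, ← add_mul, colFn_two hij, sub_mul, sum_sub_distrib,
      add_zero] at this
    exact (sub_eq_zero.1 this).symm
  · intro l l' hl'
    obtain ⟨hi, hj⟩ := hne l' hl'
    fin_cases l
    · exact ⟨hp.ne hi, (hpq i l').symm⟩
    · exact ⟨hpq l' i, hq.ne hi⟩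
    · exact ⟨hpq l' j, hq.ne hj⟩
  · intro l
    fin_cases l
    · exact hp.ne hij
    · exact (hpq j i).symm
    · exact (hpq j j).symm
  · intro l
    fin_cases l
    · exact hu.1 i
    · exact hu.2 i
    · exact hu.2 j
  · intro l l' hl'
    obtain ⟨hi, hj⟩ := hne l' hl'
    fin_cases l
    · exact ⟨hp.ne hi, (hpq i l').symm⟩
    · exact ⟨hp.ne hj, (hpq j l').symm⟩
    · exact ⟨hpq l' i, hq.ne hi⟩
  · intro l
    fin_cases l
    · exact hpq i j
    · exact hpq j j
    · exact hq.ne hij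
  · intro l
    fin_cases l
    · exact hu.1 i
    · exact hu.1 j
    · exact hu.2 i

theorem sum_chi_comp_perm (hcard : 2 * Fintype.card ι + 1 ≤ Fintype.card α) (p q : ι → α)
    (τ : Equiv.Perm ι) (hinj : Function.Injective (Sum.elim p q)) :
    ∑ r, chi k (p ∘ τ) (q ∘ τ) r * h r = ∑ r, chi k p q r * h r := by
  induction τ using Equiv.Perm.swap_induction_on generalizing p q with
  | one => rfl
  | swap_mul f x y hxy ih =>
    rw [Equiv.Perm.coe_mul, ← Function.comp_assoc, ← Function.comp_assoc,
      ih _ _ (injective_elim_comp_perm _ hinj), sum_chi_swap hh hcard hinj hxy]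

end ChiOrthogonality

/-! ### Vanishing, or membership in the span of symmetrized `chi` sums. -/

section Consequences

set_option linter.unusedSectionVars false

variable {k : Type*} [Field k] [CharZero k] {m : ℕ} {ι : Type*} [Fintype ι] [DecidableEq ι]

theorem eq_zero_of_sum_chi_eq_zero {V α : Type*} [AddCommGroup V] [Module k V] [Fintype α]
    [DecidableEq α] {X : (ι → α) → V} {h : (ι → α) → k} {N : k} {f : V}
    (hcard : 2 * Fintype.card ι ≤ Fintype.card α) (hN : N ≠ 0)
    (hsum : ∑ r, h r • X r = N • f)
    (hh : ∀ p q, Function.Injective (Sum.elim p q) → ∑ r, chi k p q r * h r = 0)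
    (hX : IsAdmissible X) : f = 0 :=
  (smul_eq_zero_iff_right hN).1 (hsum.symm.trans (sum_smul_eq_zero_of_chi_orth hcard hh hX))

theorem mem_span_of_sum_chi_comp {V α : Type*} [AddCommGroup V] [Module k V] [Fintype α]
    [DecidableEq α] {X : (ι → α) → V} {h : (ι → α) → k} {N : k} {f : V}
    (hcard : 2 * Fintype.card ι ≤ Fintype.card α) (hN : N ≠ 0)
    (hsum : ∑ r, h r • X r = N • f)
    (hh : ∀ p q (τ : Equiv.Perm ι), Function.Injective (Sum.elim p q) →
      ∑ r, chi k (p ∘ τ) (q ∘ τ) r * h r = ∑ r, chi k p q r * h r)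
    (hX : IsAdmissible X) :
    f ∈ Submodule.span k {v | ∃ p q : ι → α, Function.Injective (Sum.elim p q) ∧
      v = ∑ τ : Equiv.Perm ι, ∑ r, chi k (p ∘ τ) (q ∘ τ) r • X r} := by
  have h1 := Submodule.smul_mem _ N⁻¹ (sum_smul_mem_span_of_chi_symm hcard hh hX)
  rwa [hsum, smul_smul, inv_mul_cancel₀ hN, one_smul] at h1

/-- In the applications `2 * card ι ≤ m` and `3 ≤ m`, which together give the bound `h`. -/
theorem exists_two_unused_labels (ℓ : ι → Fin m) (h : Fintype.card ι + 2 ≤ m) :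
    ∃ y z : Fin m, y ≠ z ∧ (∀ c, ℓ c ≠ y) ∧ ∀ c, ℓ c ≠ z := by
  have h1 : 1 < ((univ.image ℓ)ᶜ).card := by
    rw [card_compl, Fintype.card_fin]
    have := card_image_le (s := univ) (f := ℓ)
    rw [card_univ] at this
    omega
  obtain ⟨y, hy, z, hz, hyz⟩ := Finset.one_lt_card.1 h1
  simp only [mem_compl, mem_image, mem_univ, true_and, not_exists] at hy hz
  exact ⟨y, z, hyz, hy, hz⟩

theorem eq_zero_of_mem_gradedPiece_of_mem_annMaxSq {d : Fin m → ℕ} (ℓ : ι → Fin m)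
    (hℓ : ∀ i, (univ.filter fun c => ℓ c = i).card = d i) (hm : 3 ≤ m)
    (hcard : 2 * Fintype.card ι + 2 ≤ m + 1) {f : GA k m}
    (hf : f ∈ gradedPiece k m d ⊓ annMaxSq k m) : f = 0 := by
  obtain ⟨y, z, hyz, hy, hz⟩ := exists_two_unused_labels ℓ (by omega)
  obtain ⟨h, N, hN, hsum, hh⟩ := exists_symmetrized_coefficients ℓ hℓ hyz hy hz hf
  exact eq_zero_of_sum_chi_eq_zero (by rw [Fintype.card_fin]; omega) hN hsum
    (fun p q hpq => sum_chi_mul_eq_zero hh (by rw [Fintype.card_fin]; omega)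
      (by rw [Fintype.card_fin]; omega) hpq) (isAdmissible_slotMonomial ℓ)

theorem mem_span_of_mem_gradedPiece_of_mem_annMaxSq {d : Fin m → ℕ} (ℓ : ι → Fin m)
    (hℓ : ∀ i, (univ.filter fun c => ℓ c = i).card = d i) (hm : 3 ≤ m)
    (hcard : 2 * Fintype.card ι + 1 ≤ m + 1) {f : GA k m}
    (hf : f ∈ gradedPiece k m d ⊓ annMaxSq k m) :
    f ∈ Submodule.span k {v | ∃ p q : ι → Fin (m + 1), Function.Injective (Sum.elim p q) ∧
      v = ∑ τ : Equiv.Perm ι, ∑ r, chi k (p ∘ τ) (q ∘ τ) r • slotMonomial k ℓ r} := by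
  obtain ⟨y, z, hyz, hy, hz⟩ := exists_two_unused_labels ℓ (by omega)
  obtain ⟨h, N, hN, hsum, hh⟩ := exists_symmetrized_coefficients ℓ hℓ hyz hy hz hf
  exact mem_span_of_sum_chi_comp (by rw [Fintype.card_fin]; omega) hN hsum
    (sum_chi_comp_perm hh (by rw [Fintype.card_fin]; omega)) (isAdmissible_slotMonomial ℓ)

end Consequences

/-! ### Permutations that move, swap or symmetrize placements. -/

section Permutations

theorem exists_perm_apply_eq {α β : Type*} [Finite α] {f g : β → α} (hf : Function.Injective f)
    (hg : Function.Injective g) : ∃ t : Equiv.Perm α, ∀ b, t (f b) = g b := by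
  classical
  refine ⟨Equiv.extendSubtype (p := (· ∈ Set.range f)) (q := (· ∈ Set.range g))
    ((Equiv.ofInjective f hf).symm.trans (Equiv.ofInjective g hg)), fun b => ?_⟩
  rw [Equiv.extendSubtype_apply_of_mem _ _ ⟨b, rfl⟩]
  simp only [Equiv.trans_apply, Equiv.ofInjective_symm_apply, Equiv.ofInjective_apply]

theorem exists_perm_comp_eq_and_comp_eq {α ι : Type*} [Finite α] {low up p q : ι → α}
    (hinj : Function.Injective (Sum.elim low up)) (hpq : Function.Injective (Sum.elim p q)) :
    ∃ t : Equiv.Perm α, t ∘ low = p ∧ t ∘ up = q := by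
  obtain ⟨t, ht⟩ := exists_perm_apply_eq hinj hpq
  exact ⟨t, funext fun c => ht (Sum.inl c), funext fun c => ht (Sum.inr c)⟩

theorem exists_perm_swapping {α ι : Type*} [Fintype α] [DecidableEq α] [DecidableEq ι]
    {p q : ι → α} (hpq : Function.Injective (Sum.elim p q)) (I : Finset ι) :
    ∃ π : Equiv.Perm α, Equiv.Perm.sign π = (-1) ^ I.card ∧ π ∘ p = I.piecewise q p ∧
      π ∘ q = I.piecewise p q ∧ ∀ x, (∀ c, x ≠ p c ∧ x ≠ q c) → π x = x := by
  have hne : ∀ i j, p i ≠ q j := fun i j hij => by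
    have := @hpq (Sum.inl i) (Sum.inr j) hij
    simp at this
  have hp : Function.Injective p := hpq.comp Sum.inl_injective
  have hq : Function.Injective q := hpq.comp Sum.inr_injective
  induction I using Finset.induction_on with
  | empty => exact ⟨1, by simp, by simp, by simp, fun _ _ => rfl⟩
  | insert a I ha ih =>
    obtain ⟨π, hs, h1, h2, h3⟩ := ih
    refine ⟨Equiv.swap (p a) (q a) * π, ?_, ?_, ?_, fun x hx => ?_⟩
    · rw [Equiv.Perm.sign_mul, hs, Equiv.Perm.sign_swap (hne a a), card_insert_of_notMem ha,
        pow_succ']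
    · rw [Equiv.Perm.coe_mul, Function.comp_assoc, h1]
      funext c
      by_cases hca : c = a
      · subst hca
        rw [Function.comp_apply, piecewise_eq_of_notMem _ _ _ ha,
          piecewise_eq_of_mem _ _ _ (mem_insert_self _ _), Equiv.swap_apply_left]
      · by_cases hc : c ∈ I
        · rw [Function.comp_apply, piecewise_eq_of_mem _ _ _ hc,
            piecewise_eq_of_mem _ _ _ (mem_insert_of_mem hc),
            Equiv.swap_apply_of_ne_of_ne (hne _ _).symm (hq.ne hca)]
        · have hc' : c ∉ insert a I := by simp [hca, hc]
          rw [Function.comp_apply, piecewise_eq_of_notMem _ _ _ hc,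
            piecewise_eq_of_notMem _ _ _ hc', Equiv.swap_apply_of_ne_of_ne (hp.ne hca) (hne _ _)]
    · rw [Equiv.Perm.coe_mul, Function.comp_assoc, h2]
      funext c
      by_cases hca : c = a
      · subst hca
        rw [Function.comp_apply, piecewise_eq_of_notMem _ _ _ ha,
          piecewise_eq_of_mem _ _ _ (mem_insert_self _ _), Equiv.swap_apply_right]
      · by_cases hc : c ∈ I
        · rw [Function.comp_apply, piecewise_eq_of_mem _ _ _ hc,
            piecewise_eq_of_mem _ _ _ (mem_insert_of_mem hc),
            Equiv.swap_apply_of_ne_of_ne (hp.ne hca) (hne _ _)]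
        · have hc' : c ∉ insert a I := by simp [hca, hc]
          rw [Function.comp_apply, piecewise_eq_of_notMem _ _ _ hc,
            piecewise_eq_of_notMem _ _ _ hc',
            Equiv.swap_apply_of_ne_of_ne (hne _ _).symm (hq.ne hca)]
    · rw [Equiv.Perm.mul_apply, h3 x hx, Equiv.swap_apply_of_ne_of_ne (hx a).1 (hx a).2]

theorem sum_symm_smul_chi (k : Type*) [Field k] [CharZero k] {ι α V : Type*} [Fintype ι] [DecidableEq ι]
    [Fintype α] [DecidableEq α] [AddCommGroup V] [Module k V] (X : (ι → α) → V) (p q : ι → α) :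
    ∑ I : Finset ι, (-1 : k) ^ I.card • ∑ τ : Equiv.Perm ι, X (I.piecewise q p ∘ τ) =
      ∑ τ : Equiv.Perm ι, ∑ r, chi k (p ∘ τ) (q ∘ τ) r • X r := by
  rw [← sum_chi_smul (k := k) (X := fun P => ∑ τ : Equiv.Perm ι, X (P ∘ τ))]
  simp only [smul_sum]
  rw [sum_comm]
  refine sum_congr rfl fun τ _ => ?_
  rw [← sum_comp_perm τ fun r => chi k (p ∘ τ) (q ∘ τ) r • X r]
  exact sum_congr rfl fun r _ => by rw [chi_comp_perm]

/-- Orbit and stabilizer: every rearrangement of `ℓ` arises from a coset of its stabilizer. -/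
theorem sum_comp_perm_eq_card_smul {ι β V : Type*} [Fintype ι] [DecidableEq ι] [DecidableEq β]
    [AddCommMonoid V] (ℓ : ι → β) (G : (ι → β) → V) :
    ∑ τ : Equiv.Perm ι, G (ℓ ∘ τ) =
      (univ.filter fun τ : Equiv.Perm ι => ℓ ∘ τ = ℓ).card •
        ∑ w ∈ univ.image fun τ : Equiv.Perm ι => ℓ ∘ τ, G w := by
  rw [sum_comp G fun τ : Equiv.Perm ι => ℓ ∘ τ, smul_sum]
  refine sum_congr rfl fun w hw => ?_
  obtain ⟨τ, -, rfl⟩ := mem_image.1 hw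
  congr 1
  refine card_equiv (Equiv.mulRight τ⁻¹) fun ρ => ?_
  simp only [mem_filter, mem_univ, true_and, Equiv.coe_mulRight, Equiv.Perm.coe_mul,
    ← Function.comp_assoc]
  constructor
  · intro h
    rw [h, Function.comp_assoc, ← Equiv.Perm.coe_mul, mul_inv_cancel]
    rfl
  · intro h
    conv_rhs => rw [← h]
    rw [Function.comp_assoc, ← Equiv.Perm.coe_mul, inv_mul_cancel]
    rfl

end Permutations

/-! ### Polytabloids of two-row shapes and their images under `theta`. -/

section TwoRowShapes

variable {k : Type*} [Field k] {m : ℕ} {ι : Type*} [Fintype ι] [DecidableEq ι]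
  {μ : Composition (m + 1)} {up low : ι → Fin (m + 1)}

/-- Columns have the form `{low c, up c}` or are singletons, so an element of `C_t` is a product of
commuting swaps, given by the set `I` of swapped columns and of sign `(-1) ^ card I`. -/
theorem sum_colStabilizer {V : Type*} [AddCommGroup V] [Module k V]
    (hinj : Function.Injective (Sum.elim low up))
    (hcol : ∀ i j, boxCol μ i = boxCol μ j ↔
      i = j ∨ ∃ c, (i = low c ∨ i = up c) ∧ (j = low c ∨ j = up c))
    (t : Equiv.Perm (Fin (m + 1))) (F : (ι → Fin (m + 1)) → V) :
    ∑ π ∈ colStabilizer μ t, (((Equiv.Perm.sign π : ℤˣ) : ℤ) : k) • F (π ∘ t ∘ low) =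
      ∑ I : Finset ι, (-1 : k) ^ I.card • F (I.piecewise (t ∘ up) (t ∘ low)) := by
  have hlu : ∀ i j, low i ≠ up j := fun i j hij => by
    have := @hinj (Sum.inl i) (Sum.inr j) hij
    simp at this
  have hl : Function.Injective low := hinj.comp Sum.inl_injective
  have hu : Function.Injective up := hinj.comp Sum.inr_injective
  have hinj' : Function.Injective (Sum.elim (t ∘ low) (t ∘ up)) := by
    rw [← Sum.comp_elim]
    exact t.injective.comp hinj
  choose π hs h1 h2 h3 using exists_perm_swapping hinj'
  have h1' : ∀ I c, π I (t (low c)) = I.piecewise (t ∘ up) (t ∘ low) c :=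
    fun I c => congrFun (h1 I) c
  have h2' : ∀ I c, π I (t (up c)) = I.piecewise (t ∘ low) (t ∘ up) c :=
    fun I c => congrFun (h2 I) c
  symm
  refine sum_bij (fun I _ => π I) (fun I _ => ?_) (fun I _ J _ hIJ => ?_) (fun ρ hρ => ?_)
    fun I _ => ?_
  · simp only [colStabilizer, mem_filter, mem_univ, true_and]
    intro j
    rw [hcol]
    by_cases hj : ∀ c, j ≠ (t ∘ low) c ∧ j ≠ (t ∘ up) c
    · rw [h3 I j hj]
      exact Or.inl rfl
    · push Not at hj
      obtain ⟨c, hc⟩ := hj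
      refine Or.inr ⟨c, ?_⟩
      by_cases hjl : j = t (low c)
      · subst hjl
        rw [h1']
        by_cases hcI : c ∈ I
        · simp [piecewise_eq_of_mem _ _ _ hcI]
        · simp [piecewise_eq_of_notMem _ _ _ hcI]
      · have := hc hjl
        subst this
        rw [Function.comp_apply, h2']
        by_cases hcI : c ∈ I
        · simp [piecewise_eq_of_mem _ _ _ hcI]
        · simp [piecewise_eq_of_notMem _ _ _ hcI]
  · change π I = π J at hIJ
    ext c
    have := h1' I c
    rw [hIJ, h1' J c] at this
    by_cases hI : c ∈ I <;> by_cases hJ : c ∈ J <;>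
      simp_all [(hlu c c).symm]
  · simp only [colStabilizer, mem_filter, mem_univ, true_and] at hρ
    have hcases : ∀ c, (ρ (t (low c)) = t (low c) ∧ ρ (t (up c)) = t (up c)) ∨
        (ρ (t (low c)) = t (up c) ∧ ρ (t (up c)) = t (low c)) := by
      have aux : ∀ c j, (j = low c ∨ j = up c) → (ρ (t j) = t (low c) ∨ ρ (t j) = t (up c)) := by
        intro c j hj
        have := hρ (t j)
        rw [hcol, Equiv.symm_apply_apply, Equiv.symm_apply_eq] at this
        rcases this with h | ⟨c', h, h'⟩
        · rcases hj with rfl | rfl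
          · exact Or.inl h
          · exact Or.inr h
        · have : c' = c := by
            rcases hj with rfl | rfl
            · rcases h' with h' | h'
              · exact (hl h').symm
              · exact absurd h' (hlu _ _)
            · rcases h' with h' | h'
              · exact absurd h'.symm (hlu _ _)
              · exact (hu h').symm
          subst this
          rwa [Equiv.symm_apply_eq, Equiv.symm_apply_eq] at h
      intro c
      have hne : ρ (t (low c)) ≠ ρ (t (up c)) := fun h => hlu c c (t.injective (ρ.injective h))
      rcases aux c _ (Or.inl rfl) with h | h <;> rcases aux c _ (Or.inr rfl) with h' | h'
      · exact absurd (h.trans h'.symm) hne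
      · exact Or.inl ⟨h, h'⟩
      · exact Or.inr ⟨h, h'⟩
      · exact absurd (h.trans h'.symm) hne
    refine ⟨univ.filter fun c => ρ (t (low c)) = t (up c), mem_univ _, ?_⟩
    ext1 j
    by_cases hj : ∀ c, j ≠ (t ∘ low) c ∧ j ≠ (t ∘ up) c
    · rw [h3 _ j hj]
      have := hρ j
      rw [hcol, Equiv.symm_apply_eq, Equiv.apply_symm_apply] at this
      rcases this with h | ⟨c, -, h⟩
      · exact h.symm
      · rw [Equiv.symm_apply_eq, Equiv.symm_apply_eq] at h
        exact absurd h (not_or.2 (hj c))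
    · push Not at hj
      obtain ⟨c, hc⟩ := hj
      have hmem : c ∈ (univ.filter fun c => ρ (t (low c)) = t (up c)) ↔
        ρ (t (low c)) = t (up c) := by simp
      have hj' : j = t (low c) ∨ j = t (up c) := or_iff_not_imp_left.2 hc
      rcases hcases c with ⟨ha, hb⟩ | ⟨ha, hb⟩
      · have hcI : c ∉ (univ.filter fun c => ρ (t (low c)) = t (up c)) := by
          rw [hmem, ha]
          exact fun h => hlu c c (t.injective h)
        rcases hj' with rfl | rfl
        · rw [h1', piecewise_eq_of_notMem _ _ _ hcI, ha, Function.comp_apply]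
        · rw [h2', piecewise_eq_of_notMem _ _ _ hcI, hb, Function.comp_apply]
      · have hcI : c ∈ (univ.filter fun c => ρ (t (low c)) = t (up c)) := hmem.2 ha
        rcases hj' with rfl | rfl
        · rw [h1', piecewise_eq_of_mem _ _ _ hcI, ha, Function.comp_apply]
        · rw [h2', piecewise_eq_of_mem _ _ _ hcI, hb, Function.comp_apply]
  · rw [hs, ← h1 I]
    simp

/-- Boxes outside `low` carry the label `0` and contribute the factor `1`. A row rearrangement of
`U` is thus a rearrangement of `ℓ`; `rowSum` lists each once, the sum over `τ` as often as the
stabilizer of `ℓ` has elements. -/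
theorem card_smul_rowSum {U : Fin (m + 1) → Fin (m + 1)} {ℓ : ι → Fin m}
    (hlow : Function.Injective low)
    (hrow : ∀ i j, boxRow μ i = boxRow μ j ↔ (i ∈ Set.range low ↔ j ∈ Set.range low))
    (hU : ∀ c, U (low c) = (ℓ c).succ) (hU0 : ∀ i ∉ Set.range low, U i = 0)
    (t : Equiv.Perm (Fin (m + 1))) :
    (univ.filter fun τ : Equiv.Perm ι => ℓ ∘ τ = ℓ).card • rowSum k m μ U t =
      ∑ τ : Equiv.Perm ι, slotMonomial k ℓ ((t ∘ low) ∘ τ) := by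
  have e1 : ∑ τ : Equiv.Perm ι, slotMonomial k ℓ ((t ∘ low) ∘ τ) =
      ∑ τ : Equiv.Perm ι, slotMonomial k (ℓ ∘ τ) (t ∘ low) := by
    rw [← Equiv.sum_comp (Equiv.inv (Equiv.Perm ι))]
    refine sum_congr rfl fun τ _ => ?_
    unfold slotMonomial
    rw [← Equiv.prod_comp τ]
    refine prod_congr rfl fun c _ => ?_
    simp
  rw [e1, sum_comp_perm_eq_card_smul ℓ fun w => slotMonomial k w (t ∘ low)]
  congr 1
  unfold rowSum
  symm
  refine sum_bij (fun w _ => Function.extend low (Fin.succ ∘ w) fun _ => 0) (fun w hw => ?_)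
    (fun w _ w' _ h => ?_) (fun S hS => ?_) fun w _ => ?_
  · obtain ⟨τ, -, rfl⟩ := mem_image.1 hw
    simp only [rowClass, mem_filter, mem_univ, true_and]
    have hρ : ∀ c, τ.extendDomain (Equiv.ofInjective low hlow) (low c) = low (τ c) := fun c => by
      have := Equiv.Perm.extendDomain_apply_image τ (Equiv.ofInjective low hlow) c
      simpa only [Equiv.ofInjective_apply] using this
    have hρ' : ∀ i ∉ Set.range low, τ.extendDomain (Equiv.ofInjective low hlow) i = i :=
      fun i hi => Equiv.Perm.extendDomain_apply_not_subtype τ _ hi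
    refine ⟨τ.extendDomain (Equiv.ofInjective low hlow), fun i => ?_, funext fun i => ?_⟩
    · by_cases hi : i ∈ Set.range low
      · obtain ⟨c, rfl⟩ := hi
        rw [hρ, hrow]
        exact iff_of_true ⟨_, rfl⟩ ⟨_, rfl⟩
      · rw [hρ' i hi]
    · by_cases hi : i ∈ Set.range low
      · obtain ⟨c, rfl⟩ := hi
        rw [Function.comp_apply, hρ, hU, hlow.extend_apply]
        rfl
      · rw [Function.comp_apply, hρ' i hi, hU0 i hi, Function.extend_apply' _ _ _ hi]
  · funext c
    have := congrFun h (low c)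
    rw [hlow.extend_apply, hlow.extend_apply] at this
    exact Fin.succ_injective _ this
  · simp only [rowClass, mem_filter, mem_univ, true_and] at hS
    obtain ⟨ρ, hρ, rfl⟩ := hS
    have hρ' : ∀ i, ρ i ∈ Set.range low ↔ i ∈ Set.range low := fun i => (hrow _ _).1 (hρ i)
    choose τ hτ using fun c => (hρ' (low c)).2 ⟨c, rfl⟩
    have hτi : Function.Injective τ := fun a b hab =>
      hlow (ρ.injective (by rw [← hτ, ← hτ, hab]))
    refine ⟨ℓ ∘ τ, mem_image.2 ⟨Equiv.ofBijective τ (Finite.injective_iff_bijective.1 hτi),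
      mem_univ _, rfl⟩, funext fun i => ?_⟩
    by_cases hi : i ∈ Set.range low
    · obtain ⟨c, rfl⟩ := hi
      rw [hlow.extend_apply, Function.comp_apply (f := U), ← hτ, hU]
      rfl
    · rw [Function.extend_apply' _ _ _ hi, Function.comp_apply, hU0 _ fun h => hi ((hρ' i).1 h)]
  · unfold alphaAt slotMonomial
    refine Fintype.prod_of_injective low hlow _ _ (fun i hi => ?_) fun c => ?_
    · rw [Function.extend_apply' _ _ _ hi]
      rfl
    · rw [hlow.extend_apply]
      rfl

theorem card_smul_theta_polytabloid [CharZero k] {T : Fin (m + 1) → Fin (m + 1)}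
    {σ : Equiv.Perm (Fin (m + 1))} {ℓ : ι → Fin m}
    (hinj : Function.Injective (Sum.elim low up))
    (hrow : ∀ i j, boxRow μ i = boxRow μ j ↔ (i ∈ Set.range low ↔ j ∈ Set.range low))
    (hcol : ∀ i j, boxCol μ i = boxCol μ j ↔
      i = j ∨ ∃ c, (i = low c ∨ i = up c) ∧ (j = low c ∨ j = up c))
    (hT : ∀ c, σ⁻¹ (T (low c)) = (ℓ c).succ) (hT0 : ∀ i ∉ Set.range low, σ⁻¹ (T i) = 0)
    (t : Equiv.Perm (Fin (m + 1))) :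
    (univ.filter fun τ : Equiv.Perm ι => ℓ ∘ τ = ℓ).card •
        theta k m μ T σ (polytabloid k μ t) =
      ∑ τ : Equiv.Perm ι, ∑ r,
        chi k ((t ∘ low) ∘ τ) ((t ∘ up) ∘ τ) r • slotMonomial k ℓ r := by
  refine Eq.trans ?_ ((sum_colStabilizer hinj hcol t
    fun P => ∑ τ : Equiv.Perm ι, slotMonomial k ℓ (P ∘ τ)).trans
    (sum_symm_smul_chi k (slotMonomial k ℓ) (t ∘ low) (t ∘ up)))
  rw [polytabloid, map_sum]
  refine smul_sum.trans (sum_congr rfl fun π _ => ?_)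
  have h1 : theta k m μ T σ (Finsupp.single (Tabloid.mk μ (π * t))
      (((Equiv.Perm.sign π : ℤˣ) : ℤ) : k)) =
      (((Equiv.Perm.sign π : ℤˣ) : ℤ) : k) • rowSum k m μ (fun i => σ⁻¹ (T i)) (π * t) :=
    Finsupp.linearCombination_single _ _ _
  rw [h1]
  refine (smul_comm _ _ _).trans (congrArg _ ?_)
  exact card_smul_rowSum (hinj.comp Sum.inl_injective) hrow hT hT0 (π * t)

/-- Any pair of injective `p`, `q` with disjoint ranges is read off the paired boxes of some tableau
`t`, so each generator is an integer multiple of the image of the polytabloid of `t`. -/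
theorem span_le_map_theta_specht [CharZero k] {T : Fin (m + 1) → Fin (m + 1)}
    {σ : Equiv.Perm (Fin (m + 1))} {ℓ : ι → Fin m}
    (hinj : Function.Injective (Sum.elim low up))
    (hrow : ∀ i j, boxRow μ i = boxRow μ j ↔ (i ∈ Set.range low ↔ j ∈ Set.range low))
    (hcol : ∀ i j, boxCol μ i = boxCol μ j ↔
      i = j ∨ ∃ c, (i = low c ∨ i = up c) ∧ (j = low c ∨ j = up c))
    (hT : ∀ c, σ⁻¹ (T (low c)) = (ℓ c).succ) (hT0 : ∀ i ∉ Set.range low, σ⁻¹ (T i) = 0) :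
    Submodule.span k {v | ∃ p q : ι → Fin (m + 1), Function.Injective (Sum.elim p q) ∧
      v = ∑ τ : Equiv.Perm ι, ∑ r, chi k (p ∘ τ) (q ∘ τ) r • slotMonomial k ℓ r} ≤
      (specht k μ).map (theta k m μ T σ) := by
  rw [Submodule.span_le]
  rintro v ⟨p, q, hpq, rfl⟩
  obtain ⟨t, rfl, rfl⟩ := exists_perm_comp_eq_and_comp_eq hinj hpq
  rw [← card_smul_theta_polytabloid hinj hrow hcol hT hT0]
  exact Submodule.smul_of_tower_mem _ _ (Submodule.mem_map_of_mem (Submodule.subset_span ⟨t, rfl⟩))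

end TwoRowShapes

/-! ### Rows and columns of the shape `(D, D - 1)`. -/

section EpsilonShape

variable {n : ℕ} (hn : 4 ≤ n) (hodd : Odd n)

theorem index_epsilonShape (i : Fin n) :
    ((epsilonShape n hn hodd).index i : ℕ) = if (i : ℕ) < halfCeil n then 0 else 1 := by
  have h1 : (i : ℕ) < (epsilonShape n hn hodd).sizeUpTo
      (((epsilonShape n hn hodd).index i : ℕ) + 1) :=
    (epsilonShape n hn hodd).lt_sizeUpTo_index_succ i
  have h2 := (epsilonShape n hn hodd).sizeUpTo_index_le i
  have h3 : ((epsilonShape n hn hodd).index i : ℕ) < 2 := ((epsilonShape n hn hodd).index i).2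
  have h4 : (epsilonShape n hn hodd).sizeUpTo 1 = halfCeil n := by
    simp [Composition.sizeUpTo, epsilonShape]
  generalize ((epsilonShape n hn hodd).index i : ℕ) = j at h1 h2 h3
  interval_cases j
  · rw [zero_add, h4] at h1
    rw [if_pos h1]
  · rw [h4] at h2
    rw [if_neg (not_lt.2 h2)]

theorem boxRow_epsilonShape (i : Fin n) :
    boxRow (epsilonShape n hn hodd) i = if (i : ℕ) < halfCeil n then 0 else 1 :=
  index_epsilonShape hn hodd i

theorem boxCol_epsilonShape (i : Fin n) :
    boxCol (epsilonShape n hn hodd) i =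
      if (i : ℕ) < halfCeil n then (i : ℕ) else i - halfCeil n := by
  unfold boxCol
  rw [Composition.coe_invEmbedding, index_epsilonShape]
  split_ifs
  · simp
  · simp [Composition.sizeUpTo, epsilonShape]

end EpsilonShape

/-! ### Labellings and semi-standard tableaux of prescribed content. -/

section Content

theorem exists_fin_map_card_fiber {N m : ℕ} (d : Fin m → ℕ) (hd : ∑ i, d i = N) :
    ∃ ℓ : Fin N → Fin m, ∀ i, (univ.filter fun c => ℓ c = i).card = d i := by
  subst hd
  refine ⟨fun c => (finSigmaFinEquiv.symm c).1, fun i => ?_⟩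
  have : (univ.filter fun c => (finSigmaFinEquiv (n := d).symm c).1 = i).card =
      (univ.filter fun x : (i : Fin m) × Fin (d i) => x.1 = i).card :=
    card_equiv finSigmaFinEquiv.symm fun c => by simp
  rw [this, ← Fintype.card_subtype, 
    Fintype.card_congr (Equiv.sigmaSubtype (β := fun i => Fin (d i)) i), Fintype.card_fin]

theorem exists_monotone_hasContent {n : ℕ} (lam : Fin n → ℕ) (hlam : ∑ i, lam i = n) :
    ∃ T : Fin n → Fin n, Monotone T ∧ HasContent T lam := by
  obtain ⟨T, hT⟩ := exists_fin_map_card_fiber lam hlam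
  refine ⟨T ∘ Tuple.sort T, Tuple.monotone_sort T, fun s => ?_⟩
  rw [← hT s]
  exact card_equiv (Tuple.sort T) fun i => by simp

theorem sum_orderedPartition {m : ℕ} (d : Fin m → ℕ) (hd : ∑ i, d i ≤ m + 1) :
    ∑ i, orderedPartition d i = m + 1 := by
  rw [orderedPartition, Fin.sum_cons]
  omega

theorem lt_halfCeil_iff_apply_eq_zero {m : ℕ} {lam : Fin (m + 1) → ℕ}
    {T : Fin (m + 1) → Fin (m + 1)} (hT : Monotone T) (hc : HasContent T lam) (i : Fin (m + 1)) :
    T i = 0 ↔ (i : ℕ) < lam 0 := by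
  rw [← hc 0, ← Fin.le_zero_iff, ← Tuple.lt_card_le_iff_apply_le_of_monotone hT]
  simp only [Fin.le_zero_iff]

theorem isSemistandard_epsilonShape {m : ℕ} (hn : 4 ≤ m + 1) (hodd : Odd (m + 1))
    {T : Fin (m + 1) → Fin (m + 1)} (hT : Monotone T)
    (hT0 : ∀ i, T i = 0 ↔ (i : ℕ) < halfCeil (m + 1)) :
    IsSemistandard (epsilonShape (m + 1) hn hodd) T := by
  constructor
  · intro i j hr hc
    rw [boxRow_epsilonShape, boxRow_epsilonShape] at hr
    rw [boxCol_epsilonShape, boxCol_epsilonShape] at hc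
    refine hT (Fin.le_def.2 ?_)
    split_ifs at hr hc <;> omega
  · intro i j _ hr
    rw [boxRow_epsilonShape, boxRow_epsilonShape] at hr
    have hi : (i : ℕ) < halfCeil (m + 1) := by
      by_contra h
      rw [if_neg h] at hr
      split_ifs at hr <;> omega
    have hj : ¬(j : ℕ) < halfCeil (m + 1) := by
      intro h
      rw [if_pos h] at hr
      omega
    rw [(hT0 i).2 hi]
    exact Fin.pos_of_ne_zero fun h => hj ((hT0 j).1 h)

end Content

/-! ### The two cases of the theorem. -/

theorem halfCeil_even (n : ℕ) (h : Even n) : 2 * halfCeil n = n := by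
  obtain ⟨q, rfl⟩ := h
  have : halfCeil (q + q) = q := by
    unfold halfCeil
    rw [show ((q + q : ℕ) : ℚ) / 2 = (q : ℚ) by push_cast; ring, Nat.ceil_natCast]
  omega

theorem gradedPiece_inf_annMaxSq_eq_bot {k : Type*} [Field k] [CharZero k] {m : ℕ} (hm : 3 ≤ m)
    (d : Fin m → ℕ) (hd : 2 * ∑ i, d i + 2 ≤ m + 1) : gradedPiece k m d ⊓ annMaxSq k m = ⊥ := by
  obtain ⟨ℓ, hℓ⟩ := exists_fin_map_card_fiber d rfl
  rw [eq_bot_iff]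
  intro f hf
  rw [Submodule.mem_bot]
  exact eq_zero_of_mem_gradedPiece_of_mem_annMaxSq ℓ hℓ hm (by rwa [Fintype.card_fin]) hf

theorem exists_semistandard_span_le {k : Type*} [Field k] [CharZero k] (m : ℕ) (hn : 4 ≤ m + 1)
    (hodd : Odd (m + 1)) (d : Fin m → ℕ) {s : ℕ} (hs : ∑ i, d i = s) (hms : m + 1 = 2 * s + 1)
    (lam : Fin (m + 1) → ℕ) (σ : Equiv.Perm (Fin (m + 1))) (hlam : Antitone lam)
    (hσ : ∀ i, orderedPartition d (σ⁻¹ i) = lam i) :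
    ∃ (T : Fin (m + 1) → Fin (m + 1)) (ℓ : Fin s → Fin m),
      IsSemistandard (epsilonShape (m + 1) hn hodd) T ∧ HasContent T lam ∧
      (∀ i, (univ.filter fun c => ℓ c = i).card = d i) ∧
      Submodule.span k {v | ∃ p q : Fin s → Fin (m + 1), Function.Injective (Sum.elim p q) ∧
        v = ∑ τ : Equiv.Perm (Fin s), ∑ r, chi k (p ∘ τ) (q ∘ τ) r • slotMonomial k ℓ r} ≤
      (specht k (epsilonShape (m + 1) hn hodd)).map
        (theta k m (epsilonShape (m + 1) hn hodd) T σ) := by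
  have hD : halfCeil (m + 1) = s + 1 := by
    have := halfCeil_odd (m + 1) hodd
    omega
  have hsum : ∑ i, lam i = m + 1 := by
    refine Eq.trans ?_ (sum_orderedPartition d (by omega))
    rw [← Equiv.sum_comp σ⁻¹ (orderedPartition d)]
    exact sum_congr rfl fun i _ => (hσ i).symm
  have ha0 : orderedPartition d 0 = s + 1 := by
    rw [orderedPartition, Fin.cons_zero]
    omega
  have hlam0 : s + 1 ≤ lam 0 := by
    have h1 := hσ (σ 0)
    rw [show ∀ x, σ⁻¹ (σ x) = x from σ.symm_apply_apply, ha0] at h1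
    rw [h1]
    exact hlam (Fin.zero_le _)
  -- Each `d i` is at most `s`, so the largest part `λ_0 ≥ s + 1` can only be the entry `n - ∑ d_i =
  -- s + 1` of `a`.
  have hσ0 : σ⁻¹ 0 = 0 := by
    by_contra h
    obtain ⟨i, hi⟩ := Fin.exists_succ_eq.2 h
    have h1 := hσ 0
    rw [← hi, orderedPartition, Fin.cons_succ] at h1
    have h2 : d i ≤ ∑ i, d i := single_le_sum (fun _ _ => Nat.zero_le _) (mem_univ i)
    omega
  have hlam0' : lam 0 = halfCeil (m + 1) := by rw [← hσ, hσ0, ha0, hD]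
  obtain ⟨T, hT, hc⟩ := exists_monotone_hasContent lam hsum
  have hT0 : ∀ i, T i = 0 ↔ (i : ℕ) < halfCeil (m + 1) := fun i => by
    rw [lt_halfCeil_iff_apply_eq_zero hT hc, hlam0']
  -- The bottom row starts at box `s + 1`, and `up c` is the box above `low c`; the last top box,
  -- number `s`, is alone in its column.
  let low : Fin s → Fin (m + 1) := fun c => ⟨s + 1 + c, by omega⟩
  let up : Fin s → Fin (m + 1) := fun c => ⟨c, by omega⟩
  have hlow : ∀ i, i ∈ Set.range low ↔ ¬(i : ℕ) < s + 1 := fun i => by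
    constructor
    · rintro ⟨c, rfl⟩
      simp only [low]
      omega
    · intro h
      exact ⟨⟨i - (s + 1), by omega⟩, Fin.ext (by simp only [low]; omega)⟩
  have hU0 : ∀ i, σ⁻¹ (T i) = 0 ↔ i ∉ Set.range low := fun i => by
    rw [hlow, not_not, ← hD, ← hT0, ← hσ0, σ⁻¹.injective.eq_iff, hσ0]
  choose ℓ hℓ using fun c =>
    Fin.exists_succ_eq.2 fun h => (hU0 (low c)).1 h ⟨c, rfl⟩
  have hlowinj : Function.Injective low := fun a b h => by
    have := congrArg Fin.val h
    simp only [low] at this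
    exact Fin.ext (by omega)
  refine ⟨T, ℓ, isSemistandard_epsilonShape hn hodd hT hT0, hc, fun i => ?_,
    span_le_map_theta_specht (low := low) (up := up) ?_ ?_ ?_ (fun c => (hℓ c).symm)
      fun i hi => (hU0 i).2 hi⟩
  · have h1 : d i = lam (σ i.succ) := by
      rw [← hσ, show ∀ x, σ⁻¹ (σ x) = x from σ.symm_apply_apply, orderedPartition, Fin.cons_succ]
    rw [h1, ← hc, ← card_image_of_injective _ hlowinj]
    congr 1
    ext j
    simp only [mem_image, mem_filter, mem_univ, true_and]
    constructor
    · rintro ⟨c, rfl, rfl⟩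
      rw [hℓ, show ∀ x, σ (σ⁻¹ x) = x from σ.apply_symm_apply]
    · intro hj
      have hj' : σ⁻¹ (T j) = i.succ := by rw [hj, show ∀ x, σ⁻¹ (σ x) = x from σ.symm_apply_apply]
      have : j ∈ Set.range low := by
        by_contra h
        rw [(hU0 j).2 h] at hj'
        exact Fin.succ_ne_zero _ hj'.symm
      obtain ⟨c, rfl⟩ := this
      exact ⟨c, Fin.succ_injective _ ((hℓ c).trans hj'), rfl⟩
  · rintro (a | a) (b | b) h <;> have := congrArg Fin.val h <;>
      simp only [Sum.elim_inl, Sum.elim_inr, low, up] at this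
    · exact congrArg _ (Fin.ext (by omega))
    · omega
    · omega
    · exact congrArg _ (Fin.ext (by omega))
  · intro i j
    rw [boxRow_epsilonShape, boxRow_epsilonShape, hlow, hlow, hD]
    split_ifs <;> simp_all
  · intro i j
    rw [boxCol_epsilonShape, boxCol_epsilonShape, hD]
    simp only [Fin.ext_iff, low, up]
    constructor
    · intro h
      by_cases hij : (i : ℕ) = j
      · exact Or.inl hij
      · right
        split_ifs at h with hi hj hj
        · exact absurd h hij
        · exact ⟨⟨i, by omega⟩, Or.inr rfl, Or.inl (by dsimp only; omega)⟩
        · exact ⟨⟨j, by omega⟩, Or.inl (by dsimp only; omega), Or.inr rfl⟩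
        · omega
    · rintro (h | ⟨c, h, h'⟩)
      · rw [h]
      · split_ifs <;> omega

end

theorem corollary4p5 {k : Type*} [Field k] [CharZero k] (m : ℕ) (hn : 4 ≤ m + 1)
    (d : Fin m → ℕ) (hd : ∑ i, d i < halfCeil (m + 1)) :
    (Even (m + 1) → gradedPiece k m d ⊓ annMaxSq k m = ⊥) ∧
    (∀ hodd : Odd (m + 1), ∀ (lam : Fin (m + 1) → ℕ) (σ : Equiv.Perm (Fin (m + 1))),
      Antitone lam → (∀ i, orderedPartition d (σ⁻¹ i) = lam i) →
      gradedPiece k m d ⊓ annMaxSq k m ≤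
        ⨆ (T : Fin (m + 1) → Fin (m + 1))
          (_ : IsSemistandard (epsilonShape (m + 1) hn hodd) T) (_ : HasContent T lam),
          (specht k (epsilonShape (m + 1) hn hodd)).map
            (theta k m (epsilonShape (m + 1) hn hodd) T σ)) := by
  refine ⟨fun heven => ?_, fun hodd lam σ hlam hσ => ?_⟩
  · have := halfCeil_even (m + 1) heven
    exact gradedPiece_inf_annMaxSq_eq_bot (by omega) d (by omega)
  · have hD := halfCeil_odd (m + 1) hodd
    -- For odd `n` the bound on `d` leaves this range, where the intersection is zero, and the
    -- single value `n = 2 * ∑ d_i + 1`.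
    by_cases hs : 2 * ∑ i, d i + 2 ≤ m + 1
    · rw [gradedPiece_inf_annMaxSq_eq_bot (by omega) d hs]
      exact bot_le
    · obtain ⟨T, ℓ, hT, hc, hℓ, hspan⟩ := exists_semistandard_span_le (k := k) m hn hodd d rfl
        (by omega) lam σ hlam hσ
      intro f hf
      have h1 := hspan (mem_span_of_mem_gradedPiece_of_mem_annMaxSq ℓ hℓ (by omega)
        (by rw [Fintype.card_fin]; omega) hf)
      exact Submodule.mem_iSup_of_mem T (Submodule.mem_iSup_of_mem hT
        (Submodule.mem_iSup_of_mem hc h1))
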